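/- **Conventions.** Let $\mathbb F$ be a complete nontrivially normed field (absolute value $|xy|=|x||y|$), $\mathbb K$ a normed field extension of $\mathbb F$, and $d\ge 1$. All functions below are $\mathbb K$-valued. A *sheaf of functions* $\mathcal F$ on $\mathbb F^d$ means a family of sets $\mathcal F(U)$ of functions on $U$, for $U\subseteq\mathbb F^d$ open, closed under restriction to smaller open sets (gluing is not required). *Spread sets.* Let $2^{\aleph_0}$ be the Cantor space with $d(x,y)=2^{-n}$, $n$ being the depth to which $x,y$ agree, and with its natural (fair coin) measure. A topological embedding $\iota:2^{\aleph_0}\to\mathbb F$ is spread if $d(\iota(x),\iota(y))\ge C\,d(x,y)^\gamma$ for some $C,\gamma>0$. A set $Y\subseteq\mathbb F^m$ is affine-spread if $(\iota_1\times\dots\times\iota_m)^{-1}(Y)$ has positive outer measure for some spread $\iota_1,\dots,\iota_m$. A set $X\subseteq\mathbb F^d$ is *spread* if $\{(x_2/x_1,\dots,x_d/x_1): x\in X,\ x_1\ne0\}\subseteq\mathbb F^{d-1}$ is affine-spread. *Gentric.* A formal power series $P=\sum_\alpha p_\alpha (x-u)^\alpha$ over $\mathbb K$ is the formal power series of $f$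 at $u$ if $f(x)-\sum_{|\alpha|<N}p_\alpha(x-u)^\alpha=O(\|x-u\|^N)$ as $x\to u$ for all $N$. A function is smooth if it is infinitely differentiable and has a formal power series at each point. $\mathcal G$ is *gentric* if its sections are smooth; whenever $f\in\mathcal G(U)$, $u\in U$ and the formal power series of $f$ at $u$ converges (as an unordered sum) on $U$, then $f$ equals its sum on $U$; and there is a spread $X$ such that $z\mapsto f(u+zx)$ is analytic near $z=0$ for all $U$, $f\in\mathcal G(U)$, $u\in U$, $x\in X$. *Gentric approximation.* Given functions $r=r_U$ with values in $[0,\infty]$ on functions on $U$, $\mathcal F$ is *gentrically approximable with respect to $r$* by $\mathcal G$ if $\mathcal G$ is gentric, $\mathcal G(U)\subseteq\mathcal F(U)$ for all $U$, and whenever $V\subseteq U$ is bounded and open with $\overline V\subseteq U$, for all $f\in\mathcal F(U)$ and $\varepsilon>0$ there is $g\in\mathcal G(V)$ with $r_V(g-f|_V)<\varepsilon$. *Noble.* A sheaf $\mathcal F$ of locally bounded functions is *noble* if there are a spread $X$, functions $r=r_U$ on functions on $U$ with values in $[0,\infty]$, and $c(x,u,t,U)\in[0,\infty]$, monotone in $t$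 and finite for $t<\infty$, such that 1. $z\mapsto f(u+zx)$ is analytic near $z=0$ for all $f\in\mathcal F(U)$, $u\in U$, $x\in X$; 2. if $f,f_n\in\mathcal F(U)$ and $r_U(f_n-f)\to0$, then $f_n\to f$ uniformly on $U$ and $r_U(f_n)\to r_U(f)$; and if $U$ is bounded and $f=h|_U$ with $h\in\mathcal F(W)$, $W\supseteq\overline U$ open, then $r_U(f)<\infty$; 3. writing $f(u+zx)=\sum_n a_n(x,u)z^n$, one has $|a_n(x,u)|\le c(x,u,r_U(f),U)^{n+1}$ for all $f\in\mathcal F(U)$, $u\in U$, $x\in X$, $n\ge0$; 4. $\mathcal F$ is gentrically approximable with respect to $r$ by some $\mathcal G$. **Theorem (edge of the wedge).** Let $\Gamma\subseteq\mathbb K^d$ be such that 1. $\mathbb F^d\subseteq\overline\Gamma$; 2. for all $x,v\in\mathbb F^d$, either $x+zv\in\Gamma$ for all $z\in\mathbb K\setminus\mathbb F$, or for none; 3. there is a spread set $X\subseteq\mathbb F^d$ such that for each $v\in X$ there is $x\in\mathbb F^d$ with $x+zv\in\Gamma$ for all $z\in\mathbb K\setminus\mathbb F$. Let $\mathcal A$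 be an additive group of functions $\Gamma\to\mathbb K$ (for example all functions, or those analytic on $\Gamma$). An *extension* of a function $f$ on $U$ is a continuous $g$ on $\Gamma\cup U$ with $g|_U=f$ and $g|_\Gamma\in\mathcal A$. For $N\subseteq\mathbb K^d$ put $\|g\|_N=\sup_{N\cap(\Gamma\cup U)}|g|$, and let $\|f\|_{U,N}\in[0,\infty]$ be the infimum of $\|g\|_N$ over all extensions $g$ of $f$ ($\infty$ if there are none). Let $\mathcal F$ be a sheaf of functions on $\mathbb F^d$ such that 1. every $f\in\mathcal F(U)$ has an extension $g$; 2. $t\mapsto f(u+tv)=\sum_n a_n(v,u)t^n$ is analytic near $t=0$ for all $f\in\mathcal F(U)$, $u\in U$, $v\in X$, and for every $U$ and every neighborhood $\hat U$ of $U$ in $\mathbb K^d$ there is $c(u,v,t)\in[0,\infty]$, monotone in $t$ and finite for $t<\infty$, such that $|a_n(v,u)|\le c(u,v,\|g\|_{\hat U})^{n+1}$ for all $f\in\mathcal F(U)$, all extensions $g$ of $f$, all $u\in U$, $v\in X$, $n\ge0$; 3. for some choice of a neighborhood $N(U)$ of $U$ in $\mathbb K^d$ for each $U$, $\mathcal F$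 is gentrically approximable with respect to $r_U(f)=\|f\|_{U,N(U)}$ by some $\mathcal G$; 4. only if $\mathbb F$ is not locally compact: whenever $U$ is bounded, $W\supseteq\overline U$ is open and $f\in\mathcal F(W)$, then $\|f|_U\|_{U,N}<\infty$ for some $\delta>0$, $N$ being the $\delta$-neighborhood of $U$ in $\mathbb K^d$. Then $\mathcal F$ is noble. Hence, if $\mathbb K$ is complete, every function in $\mathcal F$ is analytic: for $f\in\mathcal F(U)$ and $u\in U$, $f$ is the sum of a convergent power series near $u$. -/

import Mathlib

open Filter Topology MeasureTheory TopologicalSpace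
open scoped ENNReal ContDiff

noncomputable section

/-! ## Spread sets -/

/-- The natural measure on the Cantor space: the infinite product of fair coin measures. -/
def cantorMeasure : Measure (ℕ → Bool) :=
  Measure.infinitePi (fun _ : ℕ => (PMF.uniformOfFintype Bool).toMeasure)

/-- A spread embedding of the Cantor space: a topological embedding `ι` such that
`d(ι x, ι y) ≥ C d(x, y) ^ γ` for some `C, γ > 0`, where `d(x, y) = 2 ^ (-n)` and `n` is the depth
to which the distinct branches `x` and `y` agree. -/
def IsSpreadEmbedding {F : Type*} [NormedField F] (ι : (ℕ → Bool) → F) : Prop :=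
  IsEmbedding ι ∧ ∃ C γ : ℝ, 0 < C ∧ 0 < γ ∧
    ∀ x y : ℕ → Bool, x ≠ y → C * ((1 / 2 : ℝ) ^ PiNat.firstDiff x y) ^ γ ≤ dist (ι x) (ι y)

/-- Affine-spread sets. A measure evaluated at an arbitrary set is its outer measure. -/
def IsAffineSpread {F : Type*} [NormedField F] {d : ℕ} (X : Set (Fin d → F)) : Prop :=
  ∃ ι : Fin d → (ℕ → Bool) → F, (∀ i, IsSpreadEmbedding (ι i)) ∧
    0 < (Measure.pi fun _ : Fin d => cantorMeasure) {a | (fun i => ι i (a i)) ∈ X}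

/-- Spread sets in `F ^ (d + 1)`: the ratios `(x₂ / x₁, …)` form an affine-spread set in `F ^ d`. -/
def IsSpread {F : Type*} [NormedField F] {d : ℕ} (X : Set (Fin (d + 1) → F)) : Prop :=
  IsAffineSpread {y : Fin d → F | ∃ x ∈ X, x 0 ≠ 0 ∧ ∀ i, y i = x i.succ / x 0}

/-! ## Families of functions on open sets -/

/-- A family of `K`-valued functions on the open subsets of `E`, closed under restriction. -/
structure FunctionSheaf (E K : Type*) [TopologicalSpace E] where
  sections : (U : Opens E) → Set (U → K)
  restrict_mem : ∀ {U V : Opens E} (h : V ≤ U) {f : U → K}, f ∈ sections U →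
    (fun x : V => f ⟨x, h x.2⟩) ∈ sections V

namespace FunctionSheaf

/-- Extension by zero; only used locally at points of the open set `U`. -/
def zeroExt {E K : Type*} [TopologicalSpace E] [Zero K] {U : Opens E} (f : U → K) : E → K :=
  Function.extend (Subtype.val : U → E) f 0

end FunctionSheaf

section Classes

variable {F K : Type*} [NontriviallyNormedField F] [NormedField K] [NormedAlgebra F K] {d : ℕ}

/-- The function `z ↦ f (u + z x)` of one variable, near `z = 0`. -/
def slice {U : Opens (Fin d → F)} (f : U → K) (u x : Fin d → F) : F → K :=
  fun z => FunctionSheaf.zeroExt f (u + z • x)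

/-- The term of multidegree `α` of a formal power series `P` centred at `u`, evaluated at `x`. -/
def seriesTerm (P : MvPowerSeries (Fin d) K) (u x : Fin d → F) (α : Fin d →₀ ℕ) : K :=
  (∏ i, (x i - u i) ^ α i) • MvPowerSeries.coeff α P

/-- `P` is the formal power series of `f` at `u`: for every `N`, the polynomial formed by the terms
of total degree less than `N` approximates `f` near `u` up to `O(‖x - u‖ ^ N)`. -/
def HasFormalSeriesAt (f : (Fin d → F) → K) (u : Fin d → F) (P : MvPowerSeries (Fin d) K) : Prop :=
  ∀ N : ℕ, (fun x => f x - ∑ k ∈ Finset.range N,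
      ∑ α ∈ Finset.finsuppAntidiag Finset.univ k, seriesTerm P u x α)
    =O[𝓝 u] (fun x => ‖x - u‖ ^ N)

/-- Smooth functions on an open set: infinitely differentiable, with a formal power series at
every point. Over `ℝ` and `ℂ` the second condition is Taylor's theorem; over a field where
derivatives do not control the Taylor expansion it is part of the notion. -/
def IsSmooth {U : Opens (Fin d → F)} (f : U → K) : Prop :=
  ContDiffOn F ∞ (FunctionSheaf.zeroExt f) U ∧
    ∀ u : U, ∃ P : MvPowerSeries (Fin d) K, HasFormalSeriesAt (FunctionSheaf.zeroExt f) u P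

/-- Pre-gentric: smooth sections, and a section over `U` whose formal power series at some `u ∈ U`
converges on `U` is equal to the sum of that series on `U`. -/
def IsPreGentric (G : FunctionSheaf (Fin d → F) K) : Prop :=
  (∀ U, ∀ f ∈ G.sections U, IsSmooth f) ∧
  ∀ U, ∀ f ∈ G.sections U, ∀ u : U, ∀ P : MvPowerSeries (Fin d) K,
    HasFormalSeriesAt (FunctionSheaf.zeroExt f) u P →
    (∀ x : U, Summable (seriesTerm P (u : Fin d → F) x)) →
    ∀ x : U, f x = ∑' α, seriesTerm P (u : Fin d → F) x α

/-- Gentric: pre-gentric, and analytic along all slices in a spread set of directions. -/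
def IsGentric (G : FunctionSheaf (Fin (d + 1) → F) K) : Prop :=
  IsPreGentric G ∧ ∃ X : Set (Fin (d + 1) → F), IsSpread X ∧
    ∀ U, ∀ f ∈ G.sections U, ∀ u : U, ∀ x ∈ X, AnalyticAt F (slice f u x) 0

/-- `G` is a gentric subfamily of `S` which is dense in the following sense: if `V` is bounded and
open with closure inside `U`, then each section of `S` over `U`, restricted to `V`, lies in the
closure of the sections of `G` over `V` for the topology induced by `r V`. -/
def IsGentricDense (S G : FunctionSheaf (Fin (d + 1) → F) K)
    (r : (U : Opens (Fin (d + 1) → F)) → (U → K) → ℝ≥0∞) : Prop :=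
  IsGentric G ∧ (∀ U, G.sections U ⊆ S.sections U) ∧
  ∀ U V : Opens (Fin (d + 1) → F), ∀ hVU : V ≤ U,
    Bornology.IsBounded (V : Set (Fin (d + 1) → F)) →
    closure (V : Set (Fin (d + 1) → F)) ⊆ U →
    ∀ f ∈ S.sections U, ∀ ε : ℝ≥0∞, 0 < ε →
      ∃ g ∈ G.sections V, r V (g - fun x : V => f ⟨x, hVU x.2⟩) < ε

/-- Noble families of functions. The function `r U` is given on all functions on `U`, so that
`r U (fₙ - f)` makes sense also when `S.sections U` is not closed under subtraction. -/
def IsNoble (S : FunctionSheaf (Fin (d + 1) → F) K) : Prop :=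
  -- sections are locally bounded
  (∀ U, ∀ f ∈ S.sections U, ∀ u : U, ∃ W ∈ 𝓝 u, ∃ C : ℝ, ∀ x ∈ W, ‖f x‖ ≤ C) ∧
  ∃ (X : Set (Fin (d + 1) → F))
    (r : (U : Opens (Fin (d + 1) → F)) → (U → K) → ℝ≥0∞)
    (c : (Fin (d + 1) → F) → (Fin (d + 1) → F) → ℝ≥0∞ → Opens (Fin (d + 1) → F) → ℝ≥0∞)
    (G : FunctionSheaf (Fin (d + 1) → F) K),
    -- analyticity along slices in a spread set of directions
    IsSpread X ∧
    (∀ U, ∀ f ∈ S.sections U, ∀ u : U, ∀ x ∈ X, AnalyticAt F (slice f u x) 0) ∧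
    -- convergence with respect to `r`
    (∀ U, ∀ f ∈ S.sections U, ∀ fs : ℕ → U → K, (∀ n, fs n ∈ S.sections U) →
      Tendsto (fun n => r U (fs n - f)) atTop (𝓝 0) →
      TendstoUniformly fs f atTop ∧ Tendsto (fun n => r U (fs n)) atTop (𝓝 (r U f))) ∧
    -- finiteness of `r` on sections which extend beyond the closure of a bounded set
    (∀ U W : Opens (Fin (d + 1) → F), ∀ hUW : U ≤ W,
      Bornology.IsBounded (U : Set (Fin (d + 1) → F)) →
      closure (U : Set (Fin (d + 1) → F)) ⊆ W →
      ∀ f ∈ S.sections W, r U (fun x : U => f ⟨x, hUW x.2⟩) ≠ ⊤) ∧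
    -- estimates for the coefficients along slices
    (∀ x u U, Monotone fun t => c x u t U) ∧
    (∀ x u t U, t ≠ ⊤ → c x u t U ≠ ⊤) ∧
    (∀ U, ∀ f ∈ S.sections U, ∀ u : U, ∀ x ∈ X, ∀ p : FormalMultilinearSeries F F K,
      HasFPowerSeriesAt (slice f u x) p 0 → ∀ n : ℕ, ‖p.coeff n‖ₑ ≤ c x u (r U f) U ^ (n + 1)) ∧
    -- approximation by a gentric subfamily
    IsGentricDense S G r

/-! ## The wedge -/

/-- The inclusion `F ^ d ⊆ K ^ d`. -/
def toExt (K : Type*) [NormedField K] [NormedAlgebra F K] (x : Fin d → F) : Fin d → K :=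
  fun i => algebraMap F K (x i)

/-- `g` restricts to a continuous function on `Γ ∪ U` which is equal to `f` on `U` and whose
restriction to `Γ` belongs to `A`. -/
def IsWedgeExtension (Γ : Set (Fin d → K)) (A : AddSubgroup (Γ → K)) {U : Opens (Fin d → F)}
    (f : U → K) (g : (Fin d → K) → K) : Prop :=
  ContinuousOn g (Γ ∪ toExt K '' (U : Set (Fin d → F))) ∧
  (fun z : Γ => g z) ∈ A ∧
  ∀ u : U, g (toExt K (u : Fin d → F)) = f u

/-- `‖g‖_N`, the supremum of `|g|` over the part of `Γ ∪ U` in `N`. -/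
def wedgeSup (Γ : Set (Fin d → K)) (U : Opens (Fin d → F)) (N : Set (Fin d → K))
    (g : (Fin d → K) → K) : ℝ≥0∞ :=
  ⨆ z ∈ N ∩ (Γ ∪ toExt K '' (U : Set (Fin d → F))), ‖g z‖ₑ

/-- `r(f) = ‖g‖_N` for the extension `g` of `f`; the infimum if there are several extensions, and
`∞` if there is none. -/
def wedgeNorm (Γ : Set (Fin d → K)) (A : AddSubgroup (Γ → K)) (U : Opens (Fin d → F))
    (N : Set (Fin d → K)) (f : U → K) : ℝ≥0∞ :=
  ⨅ (g : (Fin d → K) → K) (_ : IsWedgeExtension Γ A f g), wedgeSup Γ U N g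

end Classes

end

/-! ## Separated points in the Cantor space -/

/-! Two independent facts are combined: sections of a noble family are analytic
(`IsNoble.analyticOnNhd`), and the wedge data make the family noble.

For the first, approximate `f` on a ball around `u` by gentric `g n`. Along each direction `x` in
the spread set, the Taylor coefficients of `g n` at `u` are values at `x` of the homogeneous parts
of its formal series, and they are at most `c ^ (k + 1)` with `c` depending on `x` but not on `n`.
Countably many sublevel sets of `c` cover a set of positive outer measure, so one of them has
positive measure. A Remez type inequality (`exists_norm_coeff_le_of_isSpreadEmbedding`) turns a
bound on such a set into a bound on the coefficients of the homogeneous polynomial. It comes from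
Lagrange interpolation: a subset of the Cantor space of measure `δ` contains `n` points whose
products of mutual distances are at least `η ^ n`, so the basis polynomials grow only geometrically.
Hence the series of all `g n` converge on a common ball, where the gentric property identifies their
sums with `g n`. Pointwise convergence there forces convergence of the coefficients, and dominated
convergence makes `f` the sum of the limit series.

For the second, `wedgeNorm` on the prescribed neighbourhood may be infinite, although extensions are
bounded on some smaller neighbourhood. It is replaced by `wedgeGauge`, which lets the neighbourhood
shrink at a cost equal to its index. Small values still control a fixed neighbourhood, and a finite
value leaves only finitely many neighbourhoods, hence finitely many Cauchy estimates, to consider.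
-/

instance instIsProbabilityMeasureCantorMeasure : IsProbabilityMeasure cantorMeasure := by
  unfold cantorMeasure; infer_instance

lemma cantorMeasure_prefix (L : ℕ) (w : Fin L → Bool) :
    cantorMeasure {a | ∀ i : Fin L, a i = w i} = ENNReal.ofReal ((1 / 2) ^ L) := by
  classical
  set t : ℕ → Set Bool := fun i => if h : i < L then {w ⟨i, h⟩} else Set.univ with ht
  have h1 : {a : ℕ → Bool | ∀ i : Fin L, a i = w i} = ((Finset.range L : Finset ℕ) : Set ℕ).pi t := by
    ext a
    simp only [Set.mem_ofPred_eq, Set.mem_pi, Finset.coe_range, Set.mem_Iio, ht]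
    constructor
    · intro h i hi
      simpa [hi] using h ⟨i, hi⟩
    · intro h i
      simpa [i.2] using h i i.2
  have h2 : ∀ b : Bool, (PMF.uniformOfFintype Bool).toMeasure {b} = ENNReal.ofReal (1 / 2) := by
    intro b
    rw [PMF.toMeasure_apply_singleton _ _ (measurableSet_singleton b), PMF.uniformOfFintype_apply,
      ENNReal.ofReal_div_of_pos two_pos]
    simp
  rw [h1, cantorMeasure, Measure.infinitePi_pi _ fun i _ => by
    simp only [ht]; split_ifs <;> measurability]
  rw [Finset.prod_congr rfl (g := fun _ => ENNReal.ofReal (1 / 2)), Finset.prod_const,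
    Finset.card_range, ← ENNReal.ofReal_pow (by norm_num)]
  intro i hi
  rw [Finset.mem_range] at hi
  simp only [ht, hi, dite_true]
  exact h2 _

lemma card_prefix_agree {L : ℕ} (w : Fin L → Bool) (l : Fin L) :
    (Finset.univ.filter fun v : Fin L → Bool => ∀ m ≤ l, v m = w m).card = 2 ^ (L - 1 - l) := by
  have : (Finset.univ.filter fun v : Fin L → Bool => ∀ m ≤ l, v m = w m) =
      Fintype.piFinset fun m => if m ≤ l then {w m} else Finset.univ := by
    ext v
    simp only [Finset.mem_filter, Finset.mem_univ, true_and, Fintype.mem_piFinset]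
    refine forall_congr' fun m => ?_
    split_ifs with h <;> simp [h]
  rw [this, Fintype.card_piFinset]
  have h2 : ∀ m : Fin L, (if m ≤ l then ({w m} : Finset Bool) else Finset.univ).card =
      if m ≤ l then 1 else 2 := fun m => by split_ifs <;> simp
  simp_rw [h2]
  rw [Finset.prod_ite, Finset.prod_const_one, one_mul, Finset.prod_const]
  congr 1
  have : (Finset.univ.filter fun m : Fin L => ¬ m ≤ l) = Finset.Ioi l := by
    ext m; simp
  rw [this, Fin.card_Ioi]

/-- Exchange the sums: for each depth `l` there are `2 ^ (L - 1 - l)` words agreeing with `w`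
through `l`, which gives a geometric sum. -/
lemma sum_prefix_agree_le {L : ℕ} (w : Fin L → Bool) :
    ∑ v : Fin L → Bool, (Finset.univ.filter fun l : Fin L => ∀ m ≤ l, v m = w m).card ≤ 2 ^ L := by
  simp_rw [Finset.card_filter]
  rw [Finset.sum_comm]
  simp_rw [← Finset.card_filter, card_prefix_agree]
  rw [Fin.sum_univ_eq_sum_range (fun l => 2 ^ (L - 1 - l)) L,
    Finset.sum_range_reflect (fun l => 2 ^ l) L]
  exact (Nat.geomSum_lt le_rfl (fun k hk => Finset.mem_range.1 hk)).le

open Classical in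
-- A cylinder of depth `L` has measure `2 ^ (-L)`, so once `2 ^ L > n / δ` the set `A` meets at
-- least `n` of them. Take one point in each of `n` such cylinders. Depths of agreement are then
-- below `L`, and their sum is at most the sum over all words, which is at most `2 ^ L`. The depth
-- is a logarithm of the distance, so this bounds products of distances from below.
lemma exists_separated_points {δ : ℝ} (hδ : 0 < δ) {A : Set (ℕ → Bool)}
    (hA : ENNReal.ofReal δ ≤ cantorMeasure A) {n : ℕ} (hn : 0 < n) :
    ∃ s : Finset (ℕ → Bool), (s : Set (ℕ → Bool)) ⊆ A ∧ s.card = n ∧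
      ∀ a ∈ s, ((∑ b ∈ s.erase a, PiNat.firstDiff a b : ℕ) : ℝ) ≤ 2 * (n / δ) := by
  classical
  have hδ1 : δ ≤ 1 := by
    have := hA.trans prob_le_one
    rwa [ENNReal.ofReal_le_one] at this
  have hn1 : (1 : ℝ) ≤ n := by exact_mod_cast hn
  have hx : 1 ≤ (n : ℝ) / δ := by rw [le_div_iff₀ hδ]; linarith
  -- The least depth with enough cylinders, so that `2 ^ L` is still at most `2 * (n / δ)`.
  obtain ⟨k, hk1, hk2⟩ := exists_nat_pow_near hx (one_lt_two)
  set L := k + 1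
  have hL : (2 : ℝ) ^ L ≤ 2 * (n / δ) := by rw [pow_succ]; linarith
  set t : Finset (Fin L → Bool) := Finset.univ.filter fun w => ∃ a ∈ A, ∀ i : Fin L, a i = w i
  have hsub : A ⊆ ⋃ w ∈ t, {a | ∀ i : Fin L, a i = w i} := by
    intro a ha
    simp only [Set.mem_iUnion]
    exact ⟨fun i => a i, by simpa [t] using ⟨a, ha, fun _ => rfl⟩, fun i => rfl⟩
  have hcard : n ≤ t.card := by
    have h1 : ENNReal.ofReal δ ≤ ENNReal.ofReal (t.card * (1 / 2) ^ L) := by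
      refine hA.trans ((measure_mono hsub).trans ((measure_biUnion_finset_le _ _).trans ?_))
      simp_rw [cantorMeasure_prefix]
      rw [Finset.sum_const, nsmul_eq_mul, ENNReal.ofReal_mul (by positivity), ENNReal.ofReal_natCast]
    rw [ENNReal.ofReal_le_ofReal_iff (by positivity)] at h1
    have h2 : (n : ℝ) < 2 ^ L * δ := by rwa [div_lt_iff₀ hδ] at hk2
    have h3 : 2 ^ L * δ ≤ t.card := by
      calc 2 ^ L * δ ≤ 2 ^ L * (t.card * (1 / 2) ^ L) := by gcongr
        _ = t.card * (2 * (1 / 2)) ^ L := by rw [mul_pow]; ring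
        _ = t.card := by norm_num
    exact_mod_cast (h2.trans_le h3).le
  obtain ⟨t', ht', hcard'⟩ := Finset.exists_subset_card_eq hcard
  have hrep : ∀ w : Fin L → Bool, ∃ a : ℕ → Bool, w ∈ t → a ∈ A ∧ ∀ i : Fin L, a i = w i := by
    intro w
    by_cases hw : w ∈ t
    · obtain ⟨a, h⟩ := (Finset.mem_filter.1 hw).2
      exact ⟨a, fun _ => h⟩
    · exact ⟨fun _ => false, fun h => absurd h hw⟩
  choose rep hrep using hrep
  have hinj : Set.InjOn rep t' := by
    intro w hw v hv h
    ext i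
    rw [← (hrep w (ht' hw)).2 i, h, (hrep v (ht' hv)).2 i]
  refine ⟨t'.image rep, ?_, ?_, ?_⟩
  · intro a ha
    obtain ⟨w, hw, rfl⟩ := Finset.mem_image.1 (Finset.mem_coe.1 ha)
    exact (hrep w (ht' hw)).1
  · rw [Finset.card_image_of_injOn hinj, hcard']
  · intro a ha
    obtain ⟨w, hw, rfl⟩ := Finset.mem_image.1 ha
    refine le_trans ?_ hL
    have key : ∑ b ∈ (t'.image rep).erase (rep w), PiNat.firstDiff (rep w) b ≤
        ∑ v ∈ t'.erase w, (Finset.univ.filter fun l : Fin L => ∀ m ≤ l, v m = w m).card := by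
      have himg : (t'.image rep).erase (rep w) = (t'.erase w).image rep := by
        ext b
        simp only [Finset.mem_erase, Finset.mem_image]
        constructor
        · rintro ⟨hb, v, hv, rfl⟩
          exact ⟨v, ⟨fun h => hb (by rw [h]), hv⟩, rfl⟩
        · rintro ⟨v, ⟨hvw, hv⟩, rfl⟩
          exact ⟨fun h => hvw (hinj hv hw h), v, hv, rfl⟩
      rw [himg, Finset.sum_image fun v hv v' hv' h => hinj (Finset.mem_of_mem_erase hv)
        (Finset.mem_of_mem_erase hv') h]
      refine Finset.sum_le_sum fun v hv => ?_
      obtain ⟨hvw, hv⟩ := Finset.mem_erase.1 hv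
      have hlt : PiNat.firstDiff (rep w) (rep v) < L := by
        by_contra! hge
        apply hvw
        ext i
        rw [← (hrep w (ht' hw)).2 i, ← (hrep v (ht' hv)).2 i,
          PiNat.apply_eq_of_lt_firstDiff (i.2.trans_le hge)]
      have : (Finset.univ.filter fun l : Fin L => (l : ℕ) < PiNat.firstDiff (rep w) (rep v)).card =
          PiNat.firstDiff (rep w) (rep v) := by
        rw [Fin.card_filter_val_lt]; omega
      rw [← this]
      refine Finset.card_le_card fun l hl => ?_
      simp only [Finset.mem_filter, Finset.mem_univ, true_and] at hl ⊢
      intro m hm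
      rw [← (hrep w (ht' hw)).2 m, ← (hrep v (ht' hv)).2 m,
        PiNat.apply_eq_of_lt_firstDiff (lt_of_le_of_lt (Fin.le_def.1 hm) hl)]
    exact_mod_cast key.trans ((Finset.sum_le_sum_of_subset (Finset.subset_univ _)).trans
      (sum_prefix_agree_le w))

/-! ## Coefficients of polynomials bounded on the image of a large subset of the Cantor space -/

lemma norm_coeff_prod_X_sub_C_le {K ι : Type*} [NormedField K] (s : Finset ι) (y : ι → K) {R : ℝ}
    (hR : ∀ i ∈ s, ‖y i‖ ≤ R) (l : ℕ) :
    ‖(∏ i ∈ s, (Polynomial.X - Polynomial.C (y i))).coeff l‖ ≤ (1 + R) ^ s.card := by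
  classical
  induction s using Finset.induction_on generalizing l with
  | empty =>
    simp only [Finset.prod_empty, Polynomial.coeff_one, Finset.card_empty, pow_zero]
    split_ifs <;> simp
  | insert i s hi ih =>
    have hs : ∀ j ∈ s, ‖y j‖ ≤ R := fun j hj => hR j (Finset.mem_insert_of_mem hj)
    have hy := hR i (Finset.mem_insert_self i s)
    have hR0 : 0 ≤ R := (norm_nonneg _).trans hy
    rw [Finset.prod_insert hi, Finset.card_insert_of_notMem hi, sub_mul, Polynomial.coeff_sub,
      Polynomial.coeff_C_mul, pow_succ, mul_add, mul_one]
    refine (norm_sub_le _ _).trans (add_le_add ?_ ?_)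
    · cases l with
      | zero => simp; positivity
      | succ l => rw [Polynomial.coeff_X_mul]; exact ih hs l
    · rw [norm_mul, mul_comm]
      exact mul_le_mul (ih hs l) hy (norm_nonneg _) (by positivity)

lemma IsSpreadEmbedding.exists_norm_le {F : Type*} [NormedField F] {ι : (ℕ → Bool) → F}
    (hι : IsSpreadEmbedding ι) : ∃ R : ℝ, ∀ a, ‖ι a‖ ≤ R := by
  obtain ⟨R, hR⟩ := (isCompact_range hι.1.continuous).isBounded.exists_norm_le
  exact ⟨R, fun a => hR _ ⟨a, rfl⟩⟩

open Classical in
lemma IsSpreadEmbedding.exists_prod_le {F : Type*} [NormedField F] {ι : (ℕ → Bool) → F}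
    (hι : IsSpreadEmbedding ι) {δ : ℝ} (hδ : 0 < δ) :
    ∃ η : ℝ, 0 < η ∧ η ≤ 1 ∧ ∀ A : Set (ℕ → Bool), ENNReal.ofReal δ ≤ cantorMeasure A →
      ∀ n : ℕ, 0 < n → ∃ s : Finset (ℕ → Bool), (s : Set (ℕ → Bool)) ⊆ A ∧ s.card = n ∧
        ∀ a ∈ s, η ^ n ≤ ∏ b ∈ s.erase a, ‖ι a - ι b‖ := by
  obtain ⟨C, γ, hC, hγ, h⟩ := hι.2
  -- With a constant at most `1`, the `n - 1` factors of a product may be bounded below using the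
  -- exponent `n`.
  set C' := min C 1 with hC'
  have hC'0 : 0 < C' := lt_min hC one_pos
  set θ : ℝ := (1 / 2 : ℝ) ^ γ with hθ
  have hθ0 : 0 < θ := by positivity
  have hθ1 : θ ≤ 1 := Real.rpow_le_one (by norm_num) (by norm_num) hγ.le
  set η := C' * θ ^ (2 / δ) with hη
  have hη0 : 0 < η := by positivity
  refine ⟨η, hη0, ?_, ?_⟩
  · have : θ ^ (2 / δ) ≤ 1 := Real.rpow_le_one hθ0.le hθ1 (by positivity)
    calc η ≤ 1 * 1 := mul_le_mul (min_le_right _ _) this (by positivity) zero_le_one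
      _ = 1 := one_mul 1
  · intro A hA n hn
    obtain ⟨s, hs, hcard, hsum⟩ := exists_separated_points hδ hA hn
    refine ⟨s, hs, hcard, fun a ha => ?_⟩
    have hb : ∀ b ∈ s.erase a, C' * θ ^ PiNat.firstDiff a b ≤ ‖ι a - ι b‖ := by
      intro b hb
      have := h a b (Finset.ne_of_mem_erase hb).symm
      rw [dist_eq_norm] at this
      refine le_trans ?_ this
      rw [hθ, ← Real.rpow_natCast, ← Real.rpow_natCast, ← Real.rpow_mul (by norm_num),
        ← Real.rpow_mul (by norm_num), mul_comm γ]
      gcongr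
      exact min_le_left _ _
    refine le_trans ?_ (Finset.prod_le_prod (fun b _ => by positivity) hb)
    rw [Finset.prod_mul_distrib, Finset.prod_const, Finset.prod_pow_eq_pow_sum, hη, mul_pow]
    refine mul_le_mul ?_ ?_ (by positivity) (by positivity)
    · refine pow_le_pow_of_le_one hC'0.le (min_le_right _ _) ?_
      rw [← hcard]; exact Finset.card_le_card (Finset.erase_subset _ _)
    · rw [← Real.rpow_natCast, ← Real.rpow_natCast, ← Real.rpow_mul hθ0.le]
      refine Real.rpow_le_rpow_of_exponent_ge hθ0 hθ1 ((hsum a ha).trans (le_of_eq ?_))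
      ring

/-- Lagrange interpolation at the nodes `y a`: the denominators are the products bounded below by `η
^ (k + 1)`, and the numerators are products of monic linear factors with bounded roots. -/
lemma norm_coeff_le_of_norm_eval_le {K κ : Type*} [NormedField K] [DecidableEq κ] (s : Finset κ)
    (y : κ → K) {R η T : ℝ} {k : ℕ} (hη : 0 < η) (hR : ∀ i ∈ s, ‖y i‖ ≤ R)
    (hcard : s.card = k + 1)
    (hprod : ∀ a ∈ s, η ^ (k + 1) ≤ ∏ b ∈ s.erase a, ‖y a - y b‖) (Q : Polynomial K)
    (hQ : Q.degree < (k + 1 : ℕ)) (hT : ∀ a ∈ s, ‖Q.eval (y a)‖ ≤ T) (l : ℕ) :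
    ‖Q.coeff l‖ ≤ (2 * (1 + R) / η) ^ (k + 1) * T := by
  have hne : s.Nonempty := Finset.card_pos.1 (by omega)
  have hR0 : 0 ≤ R := by
    obtain ⟨a, ha⟩ := hne
    exact (norm_nonneg _).trans (hR a ha)
  have hT0 : 0 ≤ T := by
    obtain ⟨a, ha⟩ := hne
    exact (norm_nonneg _).trans (hT a ha)
  have hinj : Set.InjOn y s := by
    intro a ha b hb hab
    by_contra hne
    have h1 := hprod a ha
    rw [Finset.prod_eq_zero (Finset.mem_erase.2 ⟨Ne.symm hne, hb⟩) (by rw [hab]; simp)] at h1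
    have : 0 < η ^ (k + 1) := by positivity
    linarith
  have hQ' := Lagrange.eq_interpolate_of_eval_eq (fun a => Q.eval (y a)) hinj
    (by rw [hcard]; exact hQ) fun _ _ => rfl
  rw [hQ', Lagrange.interpolate_apply, Polynomial.finsetSum_coeff]
  have hterm : ∀ a ∈ s, ‖(Polynomial.C (Q.eval (y a)) * Lagrange.basis s y a).coeff l‖ ≤
      T * ((1 + R) ^ (k + 1) / η ^ (k + 1)) := by
    intro a ha
    have hb : Lagrange.basis s y a = Polynomial.C (∏ b ∈ s.erase a, (y a - y b)⁻¹) *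
        ∏ b ∈ s.erase a, (Polynomial.X - Polynomial.C (y b)) := by
      rw [Lagrange.basis, map_prod, ← Finset.prod_mul_distrib]
      rfl
    rw [hb, Polynomial.coeff_C_mul, Polynomial.coeff_C_mul, norm_mul, norm_mul, norm_prod]
    refine mul_le_mul (hT a ha) ?_ (by positivity) hT0
    simp_rw [norm_inv]
    rw [Finset.prod_inv_distrib, div_eq_inv_mul]
    refine mul_le_mul (inv_anti₀ (by positivity) (hprod a ha)) ?_ (norm_nonneg _) (by positivity)
    refine (norm_coeff_prod_X_sub_C_le _ _ (fun b hb => hR b (Finset.mem_of_mem_erase hb)) l).trans ?_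
    refine pow_le_pow_right₀ (by linarith) ?_
    rw [← hcard]; exact Finset.card_le_card (Finset.erase_subset _ _)
  refine (norm_sum_le _ _).trans ((Finset.sum_le_sum hterm).trans ?_)
  rw [Finset.sum_const, hcard, nsmul_eq_mul, div_pow, mul_pow, mul_div_assoc, mul_assoc,
    mul_comm _ T]
  refine mul_le_mul_of_nonneg_right ?_ (by positivity)
  -- The factor `2` in the constant absorbs the number `k + 1` of interpolation terms.
  exact_mod_cast (Nat.lt_two_pow_self (n := k + 1)).le

/-- A polynomial of degree at most `k` which is bounded by `T` on the image under a spread embedding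
of a set of measure at least `δ` has coefficients at most `M ^ (k + 1) * T`. -/
lemma IsSpreadEmbedding.exists_norm_coeff_le {F : Type*} (K : Type*) [NormedField F] [NormedField K]
    [NormedAlgebra F K] {ι : (ℕ → Bool) → F} (hι : IsSpreadEmbedding ι) {δ : ℝ} (hδ : 0 < δ) :
    ∃ M : ℝ, 1 ≤ M ∧ ∀ A : Set (ℕ → Bool), ENNReal.ofReal δ ≤ cantorMeasure A →
      ∀ (k : ℕ) (q : ℕ → K) (T : ℝ),
        (∀ a ∈ A, ‖∑ j ∈ Finset.range (k + 1), ι a ^ j • q j‖ ≤ T) →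
        ∀ j ≤ k, ‖q j‖ ≤ M ^ (k + 1) * T := by
  classical
  obtain ⟨R, hR⟩ := hι.exists_norm_le
  have hR0 : 0 ≤ R := (norm_nonneg _).trans (hR fun _ => false)
  obtain ⟨η, hη0, hη1, hη⟩ := hι.exists_prod_le hδ
  refine ⟨2 * (1 + R) / η, by rw [le_div_iff₀ hη0]; linarith, ?_⟩
  intro A hA k q T hT j hj
  obtain ⟨s, hs, hcard, hprod⟩ := hη A hA (k + 1) k.succ_pos
  set Q : Polynomial K := ∑ i ∈ Finset.range (k + 1), Polynomial.monomial i (q i) with hQ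
  have hcoeff : Q.coeff j = q j := by
    rw [hQ, Polynomial.finsetSum_coeff]
    simp only [Polynomial.coeff_monomial]
    rw [Finset.sum_ite_eq' (Finset.range (k + 1)) j q]
    simp [Nat.lt_succ_of_le hj]
  rw [← hcoeff]
  refine norm_coeff_le_of_norm_eval_le s (fun a => algebraMap F K (ι a)) hη0
    (fun a _ => by rw [norm_algebraMap']; exact hR a) hcard ?_ Q ?_ ?_ j
  · intro a ha
    simp_rw [← map_sub, norm_algebraMap']
    exact hprod a ha
  · refine lt_of_le_of_lt (Polynomial.degree_sum_le _ _) ?_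
    rw [Finset.sup_lt_iff (WithBot.bot_lt_coe _)]
    intro i hi
    exact (Polynomial.degree_monomial_le i (q i)).trans_lt (by exact_mod_cast Finset.mem_range.1 hi)
  · intro a ha
    have : Q.eval (algebraMap F K (ι a)) = ∑ j ∈ Finset.range (k + 1), ι a ^ j • q j := by
      rw [hQ, Polynomial.eval_finsetSum]
      refine Finset.sum_congr rfl fun i _ => ?_
      rw [Polynomial.eval_monomial, Algebra.smul_def, map_pow, mul_comm]
    rw [this]
    exact hT a (hs ha)

/-! ### Passage to several variables by slicing -/

lemma sum_piFinset_succ {M : Type*} [AddCommMonoid M] {d : ℕ} (s : Finset ℕ)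
    (g : (Fin (d + 1) → ℕ) → M) :
    ∑ β ∈ Fintype.piFinset (fun _ : Fin (d + 1) => s), g β =
      ∑ j ∈ s, ∑ β ∈ Fintype.piFinset (fun _ : Fin d => s), g (Fin.cons j β) := by
  rw [← Finset.sum_product']
  symm
  refine Finset.sum_bij' (fun p _ => Fin.cons p.1 p.2) (fun β _ => (β 0, Fin.tail β)) ?_ ?_ ?_ ?_ ?_
  · intro p hp
    rw [Finset.mem_product, Fintype.mem_piFinset] at hp
    rw [Fintype.mem_piFinset]
    intro i
    refine Fin.cases ?_ (fun i => ?_) i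
    · exact hp.1
    · exact hp.2 i
  · intro β hβ
    rw [Fintype.mem_piFinset] at hβ
    rw [Finset.mem_product, Fintype.mem_piFinset]
    exact ⟨hβ 0, fun i => hβ i.succ⟩
  · intro p _
    simp
  · intro β _
    simp
  · intro p _
    rfl

/-- By Fubini: fibres of measure below `δ / 2` contribute at most `δ / 2` in total, so the remaining
fibres must account for the other half. -/
lemma le_measure_setOf_le_measure_fiber {α β : Type*} [MeasurableSpace α] [MeasurableSpace β]
    {μ : Measure α} {ν : Measure β} [IsProbabilityMeasure μ] [IsProbabilityMeasure ν] {δ : ℝ}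
    (hδ : 0 ≤ δ) {S : Set (α × β)} (hS : MeasurableSet S)
    (h : ENNReal.ofReal δ ≤ μ.prod ν S) :
    ENNReal.ofReal (δ / 2) ≤ μ {x | ENNReal.ofReal (δ / 2) ≤ ν (Prod.mk x ⁻¹' S)} := by
  set B := {x | ENNReal.ofReal (δ / 2) ≤ ν (Prod.mk x ⁻¹' S)} with hB
  have hmeas : Measurable fun x => ν (Prod.mk x ⁻¹' S) := measurable_measure_prodMk_left hS
  have hBm : MeasurableSet B := measurableSet_le measurable_const hmeas
  rw [Measure.prod_apply hS] at h
  have h1 : ∫⁻ x, ν (Prod.mk x ⁻¹' S) ∂μ ≤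
      ∫⁻ x, (B.indicator 1 x + ENNReal.ofReal (δ / 2)) ∂μ := by
    refine lintegral_mono fun x => ?_
    by_cases hx : x ∈ B
    · rw [Set.indicator_of_mem hx]
      exact prob_le_one.trans le_self_add
    · rw [Set.indicator_of_notMem hx, zero_add]
      exact (not_le.1 hx).le
  rw [lintegral_add_right _ measurable_const, lintegral_indicator_one hBm, lintegral_const,
    measure_univ, mul_one] at h1
  have h2 := h.trans h1
  have h3 : ENNReal.ofReal δ = ENNReal.ofReal (δ / 2) + ENNReal.ofReal (δ / 2) := by
    rw [← ENNReal.ofReal_add (by positivity) (by positivity), add_halves]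
  rw [h3] at h2
  exact (ENNReal.add_le_add_iff_right ENNReal.ofReal_ne_top).1 h2

/-- Multivariate version of `IsSpreadEmbedding.exists_norm_coeff_le`. -/
lemma exists_norm_coeff_le_of_isSpreadEmbedding {F : Type*} (K : Type*) [NormedField F]
    [NormedField K] [NormedAlgebra F K] {d : ℕ} (ι : Fin d → (ℕ → Bool) → F)
    (hι : ∀ i, IsSpreadEmbedding (ι i)) {δ : ℝ} (hδ : 0 < δ) :
    ∃ M : ℝ, 1 ≤ M ∧ ∀ A : Set (Fin d → ℕ → Bool), MeasurableSet A →
      ENNReal.ofReal δ ≤ Measure.pi (fun _ : Fin d => cantorMeasure) A →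
      ∀ (k : ℕ) (q : (Fin d → ℕ) → K) (T : ℝ),
        (∀ a ∈ A, ‖∑ β ∈ Fintype.piFinset fun _ : Fin d => Finset.range (k + 1),
          (∏ i, ι i (a i) ^ β i) • q β‖ ≤ T) →
        ∀ β : Fin d → ℕ, (∀ i, β i ≤ k) → ‖q β‖ ≤ M ^ (k + 1) * T := by
  induction d generalizing δ with
  | zero =>
    refine ⟨1, le_rfl, fun A _ hA k q T hT β _ => ?_⟩
    obtain ⟨a, ha⟩ : A.Nonempty := by
      by_contra h
      rw [Set.not_nonempty_iff_eq_empty.1 h, measure_empty] at hA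
      exact absurd (ENNReal.ofReal_pos.2 hδ) (not_lt.2 hA)
    have := hT a ha
    simp only [Fintype.piFinset_of_isEmpty, Finset.univ_eq_empty, Finset.prod_empty, one_smul,
      Fintype.sum_subsingleton _ β] at this
    simpa using this
  | succ d ih =>
    obtain ⟨M₁, hM₁, h₁⟩ := (hι 0).exists_norm_coeff_le K (half_pos hδ)
    obtain ⟨M₂, hM₂, h₂⟩ := ih (fun i => ι i.succ) (fun i => hι i.succ) (half_pos hδ)
    refine ⟨M₁ * M₂, one_le_mul_of_one_le_of_one_le hM₁ hM₂, fun A hAm hA k q T hT β hβ => ?_⟩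
    set e := MeasurableEquiv.piFinSuccAbove (fun _ : Fin (d + 1) => ℕ → Bool) 0
    have hS : MeasurableSet (e.symm ⁻¹' A) := e.symm.measurable hAm
    have hmp := (measurePreserving_piFinSuccAbove (fun _ : Fin (d + 1) => cantorMeasure) 0).symm
    rw [← hmp.measure_preimage hAm.nullMeasurableSet] at hA
    have hB := le_measure_setOf_le_measure_fiber hδ.le hS hA
    have hcons : ∀ x y, e.symm (x, y) = Fin.cons x y := fun x y => by
      simp [e, MeasurableEquiv.piFinSuccAbove]
      rfl
    -- For fixed first coordinate `x`, the coefficients in the other variables are polynomials in `ι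
    -- 0 x`. The induction hypothesis on the large fibres bounds them on a large set of `x`, where
    -- the one-variable estimate applies.
    have key : ∀ x ∈ {x | ENNReal.ofReal (δ / 2) ≤
        Measure.pi (fun _ : Fin d => cantorMeasure) (Prod.mk x ⁻¹' (e.symm ⁻¹' A))},
        ‖∑ j ∈ Finset.range (k + 1), ι 0 x ^ j • q (Fin.cons j (Fin.tail β))‖ ≤
          M₂ ^ (k + 1) * T := by
      intro x hx
      refine h₂ _ (measurable_prodMk_left hS) hx k
        (fun β' => ∑ j ∈ Finset.range (k + 1), ι 0 x ^ j • q (Fin.cons j β')) T ?_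
        (Fin.tail β) fun i => hβ i.succ
      intro a ha
      have h := hT _ ha
      rw [hcons, sum_piFinset_succ, Finset.sum_comm] at h
      convert h using 3 with β' _
      rw [Finset.smul_sum]
      refine Finset.sum_congr rfl fun j _ => ?_
      rw [smul_smul, Fin.prod_univ_succ, mul_comm]
      simp
    have := h₁ _ hB k (fun j => q (Fin.cons j (Fin.tail β))) _ key (β 0) (hβ 0)
    rw [Fin.cons_self_tail] at this
    rwa [mul_pow, mul_assoc]

/-! ## Power series in several variables -/

lemma summable_prod_pow (D : ℕ) {r : ℝ} (h0 : 0 ≤ r) (h1 : r < 1) :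
    Summable fun α : Fin D → ℕ => ∏ i, r ^ α i := by
  induction D with
  | zero => exact Summable.of_finite
  | succ D ih =>
    rw [← (Fin.consEquiv fun _ : Fin (D + 1) => ℕ).summable_iff]
    have := (summable_geometric_of_lt_one h0 h1).mul_of_nonneg ih (fun n => by positivity)
      (fun α => by positivity)
    refine this.congr fun p => ?_
    simp [Fin.prod_univ_succ, Fin.consEquiv]

lemma exists_tendsto_of_approx {K : Type*} [NormedField K] [CompleteSpace K] {a : ℕ → K}
    (h : ∀ ε > 0, ∃ b : ℕ → K, (∃ l, Tendsto b atTop (𝓝 l)) ∧ ∀ n, ‖a n - b n‖ ≤ ε) :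
    ∃ l, Tendsto a atTop (𝓝 l) := by
  apply cauchySeq_tendsto_of_complete
  rw [Metric.cauchySeq_iff]
  intro ε hε
  obtain ⟨b, ⟨l, hl⟩, hb⟩ := h (ε / 4) (by positivity)
  obtain ⟨N, hN⟩ := Metric.cauchySeq_iff.1 hl.cauchySeq (ε / 4) (by positivity)
  refine ⟨N, fun m hm n hn => ?_⟩
  have h1 := hN m hm n hn
  have h2 := hb m
  have h3 := hb n
  rw [← dist_eq_norm] at h2 h3
  have h4 := dist_triangle4 (a m) (b m) (b n) (a n)
  rw [dist_comm (b n)] at h4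
  linarith

/-- If power series in one variable with uniformly bounded growth converge pointwise near `0`,
then so do their coefficients. -/
lemma exists_tendsto_coeff {F K : Type*} [NontriviallyNormedField F] [NormedField K]
    [NormedAlgebra F K] [CompleteSpace K] {a : ℕ → ℕ → K} {C B ρ : ℝ} (hB : 0 < B) (hρ : 0 < ρ)
    (ha : ∀ n k, ‖a n k‖ ≤ C * B ^ k)
    (h : ∀ z : F, ‖z‖ < ρ → ∃ l, Tendsto (fun n => ∑' k, z ^ k • a n k) atTop (𝓝 l)) (k : ℕ) :
    ∃ l, Tendsto (fun n => a n k) atTop (𝓝 l) := by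
  have hC : 0 ≤ C := by simpa using (norm_nonneg _).trans (ha 0 0)
  induction k using Nat.strong_induction_on with
  | _ k ih =>
    refine exists_tendsto_of_approx fun ε hε => ?_
    -- The bounds on `z` ensure, in turn, convergence of the values at `z`, a geometric ratio of at
    -- most `1 / 2`, and a remainder after the term of order `k` that costs at most `ε` once divided
    -- by `z ^ k`.
    obtain ⟨z, hz0, hz⟩ := NormedField.exists_norm_lt F
      (show 0 < min (min ρ (1 / (2 * B))) (ε / (2 * (C * B ^ (k + 1)) + 1)) by positivity)
    rw [lt_min_iff, lt_min_iff] at hz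
    obtain ⟨⟨hz1, hz2⟩, hz3⟩ := hz
    have hz' : z ≠ 0 := norm_pos_iff.1 hz0
    have hzB : B * ‖z‖ ≤ 1 / 2 := by
      rw [lt_div_iff₀ (by positivity)] at hz2
      linarith
    have hterm : ∀ n j i, ‖z ^ j • a n (j + i)‖ ≤ C * B ^ i * (1 / 2) ^ j := by
      intro n j i
      rw [norm_smul, norm_pow]
      calc ‖z‖ ^ j * ‖a n (j + i)‖ ≤ ‖z‖ ^ j * (C * B ^ (j + i)) := by gcongr; exact ha n _
        _ = C * B ^ i * (B * ‖z‖) ^ j := by ring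
        _ ≤ C * B ^ i * (1 / 2) ^ j := by gcongr
    have hgeom : ∀ i, HasSum (fun j : ℕ => C * B ^ i * (1 / 2) ^ j) (C * B ^ i * 2) := fun i =>
      (hasSum_geometric_two).mul_left _
    have hsum : ∀ n i, Summable fun j => z ^ j • a n (j + i) := fun n i =>
      Summable.of_norm_bounded (hgeom i).summable fun j => hterm n j i
    choose! l hl using ih
    obtain ⟨L, hL⟩ := h z hz1
    -- Removing the lower terms, convergent by induction, and dividing by `z ^ k` leaves `a n k`
    -- plus `z` times a bounded tail.
    refine ⟨fun n => (z ^ k)⁻¹ • (∑' j, z ^ j • a n j - ∑ j ∈ Finset.range k, z ^ j • a n j),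
      ⟨_, (hL.sub (tendsto_finsetSum _ fun j hj =>
        (hl j (Finset.mem_range.1 hj)).const_smul (z ^ j))).const_smul _⟩, fun n => ?_⟩
    have hsplit := (hsum n 0).sum_add_tsum_nat_add (k + 1)
    simp only [add_zero] at hsplit
    have htail : ∑' j, z ^ (j + (k + 1)) • a n (j + (k + 1)) =
        z ^ (k + 1) • ∑' j, z ^ j • a n (j + (k + 1)) := by
      rw [← tsum_const_smul'' ]
      refine tsum_congr fun j => ?_
      rw [smul_smul, pow_add, mul_comm]
    rw [htail, Finset.sum_range_succ] at hsplit
    have hzk : z ^ k ≠ 0 := pow_ne_zero _ hz'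
    have heq : a n k - (z ^ k)⁻¹ • (∑' j, z ^ j • a n j - ∑ j ∈ Finset.range k, z ^ j • a n j) =
        -(z • ∑' j, z ^ j • a n (j + (k + 1))) := by
      rw [← hsplit, add_assoc, add_sub_cancel_left, smul_add, smul_smul, smul_smul,
        inv_mul_cancel₀ hzk, one_smul, pow_succ, ← mul_assoc, inv_mul_cancel₀ hzk, one_mul,
        sub_add_cancel_left]
    rw [heq, norm_neg, norm_smul]
    have hb : ‖∑' j, z ^ j • a n (j + (k + 1))‖ ≤ C * B ^ (k + 1) * 2 :=
      tsum_of_norm_bounded (hgeom (k + 1)) fun j => hterm n j (k + 1)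
    rw [lt_div_iff₀ (by positivity)] at hz3
    have := mul_le_mul_of_nonneg_left hb (norm_nonneg z)
    nlinarith [norm_nonneg z]

lemma norm_prod_pow_smul_le {F K : Type*} [NormedField F] [NormedField K] [NormedAlgebra F K]
    {D : ℕ} {x : Fin D → F} {α : Fin D → ℕ} {c : K} {C B ρ : ℝ}
    (hx : ∀ i, ‖x i‖ ≤ ρ) (hc : ‖c‖ ≤ C * ∏ i, B ^ α i) :
    ‖(∏ i, x i ^ α i) • c‖ ≤ C * ∏ i, (ρ * B) ^ α i := by
  rw [norm_smul, norm_prod]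
  simp_rw [norm_pow]
  calc (∏ i, ‖x i‖ ^ α i) * ‖c‖ ≤ (∏ i, ρ ^ α i) * (C * ∏ i, B ^ α i) := by
        refine mul_le_mul (Finset.prod_le_prod (fun i _ => by positivity) fun i _ => ?_) hc
          (norm_nonneg _) (Finset.prod_nonneg fun i _ => pow_nonneg ((norm_nonneg _).trans (hx i)) _)
        exact pow_le_pow_left₀ (norm_nonneg _) (hx i) _
    _ = C * ∏ i, (ρ * B) ^ α i := by
        simp_rw [mul_pow]
        rw [Finset.prod_mul_distrib]
        ring

/-- Multivariate version of `exists_tendsto_coeff`. -/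
lemma exists_tendsto_coeff_pi {F K : Type*} [NontriviallyNormedField F] [NormedField K]
    [NormedAlgebra F K] [CompleteSpace K] {D : ℕ} {p : ℕ → (Fin D → ℕ) → K} {C B ρ : ℝ}
    (hB : 0 < B) (hρ : 0 < ρ) (hρB : ρ * B < 1) (hp : ∀ n α, ‖p n α‖ ≤ C * ∏ i, B ^ α i)
    (h : ∀ x : Fin D → F, (∀ i, ‖x i‖ < ρ) →
      ∃ l, Tendsto (fun n => ∑' α, (∏ i, x i ^ α i) • p n α) atTop (𝓝 l)) (α : Fin D → ℕ) :
    ∃ l, Tendsto (fun n => p n α) atTop (𝓝 l) := by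
  induction D generalizing C with
  | zero =>
    obtain ⟨l, hl⟩ := h (fun i => i.elim0) fun i => i.elim0
    refine ⟨l, hl.congr fun n => ?_⟩
    rw [tsum_eq_single α fun β hβ => absurd (Subsingleton.elim β α) hβ]
    simp
  | succ D ih =>
    have hsum := summable_prod_pow D (mul_pos hρ hB).le hρB
    have hsum' := summable_prod_pow (D + 1) (mul_pos hρ hB).le hρB
    have hp' : ∀ n k (β : Fin D → ℕ), ‖p n (Fin.cons k β)‖ ≤ C * B ^ k * ∏ i, B ^ β i := by
      intro n k β
      have := hp n (Fin.cons k β)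
      rw [Fin.prod_univ_succ] at this
      simpa [mul_assoc] using this
    rw [← Fin.cons_self_tail α]
    refine ih (C := C * B ^ α 0) (p := fun n β => p n (Fin.cons (α 0) β)) (fun n β => hp' n _ β)
      (fun x hx => ?_) (Fin.tail α)
    -- With the last `D` variables fixed at `x`, these are the coefficients in the first variable,
    -- to which the one-variable lemma applies.
    set a : ℕ → ℕ → K := fun n k => ∑' β : Fin D → ℕ, (∏ i, x i ^ β i) • p n (Fin.cons k β)
    refine exists_tendsto_coeff (F := F) (a := a) (C := C * ∑' β : Fin D → ℕ, ∏ i, (ρ * B) ^ β i)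
      hB hρ (fun n k => ?_) (fun z hz => ?_) (α 0)
    · rw [mul_right_comm]
      exact tsum_of_norm_bounded (hsum.hasSum.mul_left _) fun β =>
        norm_prod_pow_smul_le (fun i => (hx i).le) (hp' n k β)
    · have hzx : ∀ i : Fin (D + 1), ‖(Fin.cons z x : Fin (D + 1) → F) i‖ < ρ := by
        intro i
        refine Fin.cases ?_ (fun i => ?_) i
        · exact hz
        · exact hx i
      obtain ⟨l, hl⟩ := h (Fin.cons z x) hzx
      refine ⟨l, hl.congr fun n => ?_⟩
      have hs : Summable fun α : Fin (D + 1) → ℕ =>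
          (∏ i, (Fin.cons z x : Fin (D + 1) → F) i ^ α i) • p n α :=
        Summable.of_norm_bounded (hsum'.mul_left C) fun α =>
          norm_prod_pow_smul_le (fun i => (hzx i).le) (hp n α)
      rw [← (Fin.consEquiv fun _ : Fin (D + 1) => ℕ).tsum_eq]
      rw [← (Fin.consEquiv fun _ : Fin (D + 1) => ℕ).summable_iff] at hs
      refine hs.tsum_prod.trans ?_
      refine tsum_congr fun k => ?_
      rw [← tsum_const_smul'']
      refine tsum_congr fun β => ?_
      rw [smul_smul]
      simp [Fin.consEquiv, Fin.prod_univ_succ]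

/-- Spelling a monomial as a word of `k` coordinates exhibits it as the diagonal of a multilinear
map, the form required by `FormalMultilinearSeries`. -/
lemma exists_word {D k : ℕ} {α : Fin D →₀ ℕ} (hα : ∑ i, α i = k) (R : Type*) [CommMonoid R] :
    ∃ w : Fin k → Fin D, ∀ v : Fin D → R, ∏ j, v (w j) = ∏ i, v i ^ α i := by
  have hcard : (Finsupp.toMultiset α).toList.length = k := by
    rw [Multiset.length_toList, Finsupp.card_toMultiset, Finsupp.sum_fintype _ _ fun _ => rfl, ← hα]
    rfl
  subst hcard
  refine ⟨fun j => (Finsupp.toMultiset α).toList.get j, fun v => ?_⟩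
  rw [← List.prod_ofFn]
  have : List.ofFn (fun j => v ((Finsupp.toMultiset α).toList.get j)) =
      (Finsupp.toMultiset α).toList.map v := by
    rw [show (fun j => v ((Finsupp.toMultiset α).toList.get j)) =
      v ∘ (Finsupp.toMultiset α).toList.get from rfl, ← List.map_ofFn, List.ofFn_get]
  rw [this, ← Multiset.prod_coe, ← Multiset.map_coe, Multiset.coe_toList, Finsupp.toMultiset_map,
    Finsupp.prod_toMultiset, Finsupp.prod_mapDomain_index (by simp) (by intros; rw [pow_add]),
    Finsupp.prod_fintype _ _ (by simp)]

lemma exists_multilinear_monomial {F K : Type*} [NontriviallyNormedField F] [NormedField K]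
    [NormedAlgebra F K] {D k : ℕ} {α : Fin D →₀ ℕ} (hα : ∑ i, α i = k) (c : K) :
    ∃ m : (Fin D → F)[×k]→L[F] K, (∀ v, (m fun _ => v) = (∏ i, v i ^ α i) • c) ∧ ‖m‖ ≤ ‖c‖ := by
  obtain ⟨w, hw⟩ := exists_word hα F
  refine ⟨((ContinuousMultilinearMap.mkPiAlgebra F (Fin k) F).compContinuousLinearMap
    fun j => ContinuousLinearMap.proj (w j)).smulRight c, fun v => ?_, ?_⟩
  · simp [hw v]
  · refine ContinuousMultilinearMap.opNorm_le_bound (norm_nonneg _) fun v => ?_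
    simp only [ContinuousMultilinearMap.smulRight_apply,
      ContinuousMultilinearMap.compContinuousLinearMap_apply, ContinuousLinearMap.proj_apply,
      ContinuousMultilinearMap.mkPiAlgebra_apply, norm_smul, norm_prod]
    rw [mul_comm]
    refine mul_le_mul_of_nonneg_left ?_ (norm_nonneg _)
    exact Finset.prod_le_prod (fun _ _ => norm_nonneg _) fun j _ => norm_le_pi_norm (v j) (w j)

section
variable {F K : Type*} [NontriviallyNormedField F] [NormedField K] [NormedAlgebra F K] {D : ℕ}

lemma summable_prod_pow_finsupp (D : ℕ) {r : ℝ} (h0 : 0 ≤ r) (h1 : r < 1) :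
    Summable fun α : Fin D →₀ ℕ => ∏ i, r ^ α i :=
  (Equiv.summable_iff (f := fun α : Fin D → ℕ => ∏ i, r ^ α i) Finsupp.equivFunOnFinite).2
    (summable_prod_pow D h0 h1)

lemma norm_seriesTerm_le {P : MvPowerSeries (Fin D) K} {u x : Fin D → F} {C B ρ : ℝ}
    (hP : ∀ α : Fin D →₀ ℕ, ‖MvPowerSeries.coeff α P‖ ≤ C * ∏ i, B ^ α i)
    (hx : ‖x - u‖ ≤ ρ) (α : Fin D →₀ ℕ) : ‖seriesTerm P u x α‖ ≤ C * ∏ i, (ρ * B) ^ α i :=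
  norm_prod_pow_smul_le (x := x - u) (fun i => (norm_le_pi_norm _ i).trans hx) (hP α)

lemma summable_seriesTerm [CompleteSpace K] {P : MvPowerSeries (Fin D) K} {u x : Fin D → F}
    {C B ρ : ℝ} (hB : 0 < B) (hρB : ρ * B < 1)
    (hP : ∀ α : Fin D →₀ ℕ, ‖MvPowerSeries.coeff α P‖ ≤ C * ∏ i, B ^ α i)
    (hx : ‖x - u‖ ≤ ρ) : Summable (seriesTerm P u x) :=
  Summable.of_norm_bounded ((summable_prod_pow_finsupp D
    (mul_nonneg ((norm_nonneg _).trans hx) hB.le) hρB).mul_left C) (norm_seriesTerm_le hP hx)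

/-- The sum of a power series in several variables with coefficients of geometric growth is
analytic at the centre. -/
lemma analyticAt_of_eq_tsum_seriesTerm [CompleteSpace K] {P : MvPowerSeries (Fin D) K}
    {u : Fin D → F} {f : (Fin D → F) → K} {C B ρ : ℝ} (hB : 0 < B) (hρ : 0 < ρ) (hρB : ρ * B < 1)
    (hP : ∀ α : Fin D →₀ ℕ, ‖MvPowerSeries.coeff α P‖ ≤ C * ∏ i, B ^ α i)
    (hf : ∀ x, ‖x - u‖ < ρ → f x = ∑' α, seriesTerm P u x α) : AnalyticAt F f u := by
  have hC : 0 ≤ C := by simpa using (norm_nonneg _).trans (hP 0)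
  have hmem : ∀ {k : ℕ} {α : Fin D →₀ ℕ}, α ∈ Finset.finsuppAntidiag Finset.univ k ↔
      ∑ i, α i = k := by
    intro k α
    simp [Finset.mem_finsuppAntidiag]
  have hm : ∀ (k : ℕ) (α : Fin D →₀ ℕ), ∃ m : (Fin D → F)[×k]→L[F] K, ∑ i, α i = k →
      (∀ v, (m fun _ => v) = (∏ i, v i ^ α i) • MvPowerSeries.coeff α P) ∧
        ‖m‖ ≤ ‖MvPowerSeries.coeff α P‖ := by
    intro k α
    by_cases h : ∑ i, α i = k
    · obtain ⟨m, h⟩ := exists_multilinear_monomial (F := F) h (MvPowerSeries.coeff α P)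
      exact ⟨m, fun _ => h⟩
    · exact ⟨0, fun h' => absurd h' h⟩
  choose m hm using hm
  let q : FormalMultilinearSeries F (Fin D → F) K :=
    fun k => ∑ α ∈ Finset.finsuppAntidiag Finset.univ k, m k α
  have hs := (summable_prod_pow_finsupp D (mul_pos hρ hB).le hρB).mul_left C
  refine ⟨q, ENNReal.ofReal ρ, ?_, ENNReal.ofReal_pos.2 hρ, ?_⟩
  -- Comparing each degree with the sum over all multi-indices avoids counting monomials.
  · refine q.le_radius_of_bound (∑' α : Fin D →₀ ℕ, C * ∏ i, (ρ * B) ^ α i) fun k => ?_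
    refine le_trans ?_ (hs.sum_le_tsum (Finset.finsuppAntidiag Finset.univ k)
      fun α _ => by positivity)
    rw [Real.coe_toNNReal _ hρ.le]
    refine (mul_le_mul_of_nonneg_right (norm_sum_le _ _) (by positivity)).trans ?_
    rw [Finset.sum_mul]
    refine Finset.sum_le_sum fun α hα => ?_
    have hα' := hmem.1 hα
    calc ‖m k α‖ * ρ ^ k ≤ (C * ∏ i, B ^ α i) * ρ ^ k := by
          gcongr
          exact (hm k α hα').2.trans (hP α)
      _ = C * ∏ i, (ρ * B) ^ α i := by
          rw [Finset.prod_pow_eq_pow_sum, Finset.prod_pow_eq_pow_sum, hα', mul_pow]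
          ring
  · intro y hy
    have hy' : ‖y‖ < ρ := by
      rwa [Metric.eball_ofReal, mem_ball_zero_iff] at hy
    have hyu : ‖u + y - u‖ < ρ := by rwa [add_sub_cancel_left]
    have hsum := (summable_seriesTerm hB hρB hP hyu.le).hasSum
    rw [← hf _ hyu] at hsum
    convert hsum.tsum_fiberwise (fun α : Fin D →₀ ℕ => ∑ i, α i) using 1
    funext k
    have hset : (fun α : Fin D →₀ ℕ => ∑ i, α i) ⁻¹' {k} =
        ((Finset.finsuppAntidiag Finset.univ k : Finset (Fin D →₀ ℕ)) : Set (Fin D →₀ ℕ)) := by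
      ext α
      rw [Finset.mem_coe, hmem]
      rfl
    rw [hset, Finset.tsum_subtype' (Finset.finsuppAntidiag Finset.univ k)
      (fun α => seriesTerm P u (u + y) α)]
    simp only [q, sum_apply]
    refine Finset.sum_congr rfl fun α hα => ?_
    rw [(hm k α (hmem.1 hα)).1 y]
    simp [seriesTerm]

end

/-! ## Homogeneous parts of formal power series -/

section
variable {F K : Type*} [NontriviallyNormedField F] [NormedField K] [NormedAlgebra F K] {d : ℕ}

/-- The value at `v` of the homogeneous part of degree `k` of a formal power series. -/
noncomputable def homogeneousPart (P : MvPowerSeries (Fin d) K) (k : ℕ) (v : Fin d → F) : K :=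
  ∑ α ∈ Finset.finsuppAntidiag Finset.univ k, (∏ i, v i ^ α i) • MvPowerSeries.coeff α P

lemma mem_finsuppAntidiag_univ {k : ℕ} {α : Fin d →₀ ℕ} :
    α ∈ Finset.finsuppAntidiag Finset.univ k ↔ ∑ i, α i = k := by
  simp [Finset.mem_finsuppAntidiag]

lemma sum_seriesTerm_add_smul (P : MvPowerSeries (Fin d) K) (u x : Fin d → F) (k : ℕ) (z : F) :
    ∑ α ∈ Finset.finsuppAntidiag Finset.univ k, seriesTerm P u (u + z • x) α =
      z ^ k • homogeneousPart P k x := by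
  rw [homogeneousPart, Finset.smul_sum]
  refine Finset.sum_congr rfl fun α hα => ?_
  rw [seriesTerm, smul_smul]
  congr 1
  simp only [Pi.add_apply, Pi.smul_apply, add_sub_cancel_left, smul_eq_mul, mul_pow]
  rw [Finset.prod_mul_distrib, Finset.prod_pow_eq_pow_sum, mem_finsuppAntidiag_univ.1 hα]

/-- Uniqueness of asymptotic expansions: once the lower terms vanish, `z ^ k • b k` is of order `‖z‖
^ (k + 1)`, which forces `b k = 0`. -/
lemma eq_zero_of_forall_sum_isBigO {b : ℕ → K}
    (h : ∀ N : ℕ, (fun z : F => ∑ k ∈ Finset.range N, z ^ k • b k) =O[𝓝 0] fun z => ‖z‖ ^ N)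
    (k : ℕ) : b k = 0 := by
  induction k using Nat.strong_induction_on with
  | _ k ih =>
    have h1 : (fun z : F => ContinuousMultilinearMap.mkPiRing F (Fin k) (b k) fun _ => z)
        =O[𝓝 0] fun z => ‖z‖ ^ (k + 1) := by
      refine (h (k + 1)).congr_left fun z => ?_
      rw [Finset.sum_range_succ, Finset.sum_eq_zero fun j hj => by
        rw [ih j (Finset.mem_range.1 hj), smul_zero], zero_add]
      simp
    simpa using h1.continuousMultilinearMap_apply_eq_zero 1

/-- Both sides are coefficients of asymptotic expansions of the same function of `z`: one is the
restriction of `P` to a line, the other the power series of the slice. -/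
lemma HasFormalSeriesAt.coeff_slice_eq {f : (Fin d → F) → K} {u x : Fin d → F}
    {P : MvPowerSeries (Fin d) K} (hP : HasFormalSeriesAt f u P)
    {p : FormalMultilinearSeries F F K} (hp : HasFPowerSeriesAt (fun z : F => f (u + z • x)) p 0)
    (k : ℕ) : p.coeff k = homogeneousPart P k x := by
  rw [← sub_eq_zero]
  refine eq_zero_of_forall_sum_isBigO (F := F) (b := fun k => p.coeff k - homogeneousPart P k x)
    (fun N => ?_) k
  have h1 := hp.isBigO_sub_partialSum_pow N
  have htend : Tendsto (fun z : F => u + z • x) (𝓝 0) (𝓝 u) := by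
    have : Continuous fun z : F => u + z • x := by fun_prop
    simpa using this.tendsto 0
  have h2 := (hP N).comp_tendsto htend
  have h3 : ((fun y => ‖y - u‖ ^ N) ∘ fun z : F => u + z • x) =O[𝓝 0] fun z => ‖z‖ ^ N := by
    refine Asymptotics.IsBigO.of_bound (‖x‖ ^ N) (Eventually.of_forall fun z => ?_)
    simp only [Function.comp_apply, add_sub_cancel_left, norm_smul, mul_pow]
    rw [norm_mul, mul_comm]
    simp
  refine ((h2.trans h3).sub h1).congr_left fun z => ?_
  simp only [Function.comp_apply, zero_add, FormalMultilinearSeries.partialSum,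
    FormalMultilinearSeries.apply_eq_pow_smul_coeff, sum_seriesTerm_add_smul, smul_sub,
    Finset.sum_sub_distrib]
  ring

open Classical in
-- Dividing a form of degree `k` by `x 0 ^ k` gives a polynomial in the ratios, and the lost
-- exponent is recovered as `k - ∑ β i`. Coefficients are padded by zero so that the sum runs over a
-- box, as the polynomial inequality requires.
lemma sum_dehomogenize (P : MvPowerSeries (Fin (d + 1)) K) (k : ℕ) {x : Fin (d + 1) → F}
    (hx : x 0 ≠ 0) {y : Fin d → F} (hy : ∀ i, y i = x i.succ / x 0) :
    ∑ β ∈ Fintype.piFinset fun _ : Fin d => Finset.range (k + 1), (∏ i, y i ^ β i) •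
      (if ∑ i, β i ≤ k then MvPowerSeries.coeff
        (Finsupp.equivFunOnFinite.symm (Fin.cons (k - ∑ i, β i) β)) P else 0) =
      (x 0 ^ k)⁻¹ • homogeneousPart P k x := by
  rw [homogeneousPart, Finset.smul_sum]
  symm
  have hcons : ∀ α : Fin (d + 1) →₀ ℕ, ∑ i, α i = k →
      Finsupp.equivFunOnFinite.symm (Fin.cons (k - ∑ i, Fin.tail α i) (Fin.tail α)) = α := by
    intro α hα
    rw [Fin.sum_univ_succ] at hα
    have : k - ∑ i, Fin.tail α i = α 0 := by
      simp only [Fin.tail]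
      omega
    rw [this, Fin.cons_self_tail]
    ext i
    simp
  have hle : ∀ α : Fin (d + 1) →₀ ℕ, ∑ i, α i = k → ∑ i, Fin.tail α i ≤ k := by
    intro α hα
    rw [Fin.sum_univ_succ] at hα
    simp only [Fin.tail]
    omega
  refine Finset.sum_of_injOn (fun α => Fin.tail α) ?_ ?_ ?_ ?_
  · intro α hα α' hα' h
    rw [Finset.mem_coe, mem_finsuppAntidiag_univ] at hα hα'
    rw [← hcons α hα, ← hcons α' hα']
    have h' : Fin.tail (α : Fin (d + 1) → ℕ) = Fin.tail (α' : Fin (d + 1) → ℕ) := h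
    rw [h']
  · intro α hα
    rw [Finset.mem_coe, mem_finsuppAntidiag_univ] at hα
    rw [Finset.mem_coe, Fintype.mem_piFinset]
    intro i
    rw [Finset.mem_range, Nat.lt_succ_iff]
    exact (Finset.single_le_sum (fun _ _ => Nat.zero_le _) (Finset.mem_univ i)).trans (hle α hα)
  · intro β _ hβ
    split_ifs with h
    · refine absurd ⟨Finsupp.equivFunOnFinite.symm (Fin.cons (k - ∑ i, β i) β), ?_, ?_⟩ hβ
      · rw [Finset.mem_coe, mem_finsuppAntidiag_univ, Fin.sum_univ_succ]
        simp [h]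
      · funext i
        simp [Fin.tail]
    · rw [smul_zero]
  · intro α hα
    rw [mem_finsuppAntidiag_univ] at hα
    rw [if_pos (hle α hα), hcons α hα, smul_smul]
    congr 1
    rw [inv_mul_eq_iff_eq_mul₀ (pow_ne_zero _ hx)]
    nth_rewrite 1 [← hα]
    rw [← Finset.prod_pow_eq_pow_sum, Fin.prod_univ_succ, Fin.prod_univ_succ, mul_assoc,
      ← Finset.prod_mul_distrib]
    congr 1
    refine Finset.prod_congr rfl fun i _ => ?_
    rw [hy, div_pow, Fin.tail, mul_div_cancel₀ _ (pow_ne_zero _ hx)]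

/-- A bound for the homogeneous parts along a spread set of directions implies a bound for the
coefficients. -/
lemma exists_norm_coeff_le_of_isSpread {X : Set (Fin (d + 1) → F)} (hX : IsSpread X)
    {κ : Type*} (P : κ → MvPowerSeries (Fin (d + 1)) K)
    (h : ∀ x ∈ X, ∃ c : ℝ, ∀ n k, ‖homogeneousPart (P n) k x‖ ≤ c ^ (k + 1)) :
    ∃ C B : ℝ, 0 < B ∧ ∀ n (α : Fin (d + 1) →₀ ℕ),
      ‖MvPowerSeries.coeff α (P n)‖ ≤ C * ∏ i, B ^ α i := by
  classical
  obtain ⟨ι, hι, hpos⟩ := hX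
  set q : κ → ℕ → (Fin d → ℕ) → K := fun n k β => if ∑ i, β i ≤ k then MvPowerSeries.coeff
        (Finsupp.equivFunOnFinite.symm (Fin.cons (k - ∑ i, β i) β)) (P n) else 0 with hq
  -- These sets are closed, hence measurable, whether or not the spread set is. They make the
  -- direction-dependent bound uniform.
  set A : ℕ → Set (Fin d → ℕ → Bool) := fun m => {a | ∀ n k,
    ‖∑ β ∈ Fintype.piFinset fun _ : Fin d => Finset.range (k + 1),
      (∏ i, ι i (a i) ^ β i) • q n k β‖ ≤ (m : ℝ) ^ (k + 1)} with hA
  have hclosed : ∀ m, IsClosed (A m) := by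
    intro m
    simp only [hA, Set.ofPred_forall]
    refine isClosed_iInter fun n => isClosed_iInter fun k => isClosed_le ?_ continuous_const
    refine continuous_norm.comp (continuous_finsetSum _ fun β _ => ?_)
    refine Continuous.smul (continuous_finsetProd _ fun i _ => ?_) continuous_const
    exact ((hι i).1.continuous.comp (continuous_apply i)).pow _
  have hcover : {a | (fun i => ι i (a i)) ∈ {y : Fin d → F | ∃ x ∈ X, x 0 ≠ 0 ∧
      ∀ i, y i = x i.succ / x 0}} ⊆ ⋃ m, A m := by
    rintro a ⟨x, hxX, hx0, hy⟩
    obtain ⟨c, hc⟩ := h x hxX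
    obtain ⟨m, hm⟩ := exists_nat_ge (max 1 ‖x 0‖⁻¹ * |c|)
    refine Set.mem_iUnion.2 ⟨m, fun n k => ?_⟩
    simp only [hq]
    rw [sum_dehomogenize (P n) k hx0 hy, norm_smul, norm_inv, norm_pow, ← inv_pow]
    calc ‖x 0‖⁻¹ ^ k * ‖homogeneousPart (P n) k x‖
        ≤ max 1 ‖x 0‖⁻¹ ^ (k + 1) * |c| ^ (k + 1) := by
          refine mul_le_mul ?_ ((hc n k).trans ?_) (norm_nonneg _) (by positivity)
          · exact (pow_le_pow_left₀ (by positivity) (le_max_right _ _) _).trans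
              (pow_le_pow_right₀ (le_max_left _ _) k.le_succ)
          · rw [← abs_pow]; exact le_abs_self _
      _ = (max 1 ‖x 0‖⁻¹ * |c|) ^ (k + 1) := (mul_pow _ _ _).symm
      _ ≤ (m : ℝ) ^ (k + 1) := by gcongr
  -- Countable subadditivity holds for outer measure, so a cover of a set of positive outer measure
  -- cannot consist of null sets only.
  obtain ⟨m, hm⟩ : ∃ m, 0 < Measure.pi (fun _ : Fin d => cantorMeasure) (A m) := by
    by_contra! hzero
    refine (hpos.trans_le (measure_mono hcover)).ne' (measure_iUnion_null fun m => ?_)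
    exact le_antisymm (hzero m) zero_le
  obtain ⟨M, hM1, hM⟩ := exists_norm_coeff_le_of_isSpreadEmbedding K ι hι
    (ENNReal.toReal_pos hm.ne' (measure_ne_top _ _))
  have hm0 : 0 ≤ (m : ℝ) := Nat.cast_nonneg m
  refine ⟨M * (m + 1), M * (m + 1), by positivity, fun n α => ?_⟩
  have hα := Fin.sum_univ_succ α
  have h1 := hM (A m) (hclosed m).measurableSet (ENNReal.ofReal_toReal (measure_ne_top _ _)).le
    (∑ i, α i) (q n (∑ i, α i)) ((m : ℝ) ^ (∑ i, α i + 1)) (fun a ha => ha n _) (Fin.tail α)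
    (fun i => Finset.single_le_sum (f := fun i => α i) (fun _ _ => Nat.zero_le _)
      (Finset.mem_univ i.succ))
  have h2 : q n (∑ i, α i) (Fin.tail α) = MvPowerSeries.coeff α (P n) := by
    simp only [hq]
    rw [if_pos (by simp only [Fin.tail]; omega)]
    congr 2
    have : ∑ i, α i - ∑ i, Fin.tail α i = α 0 := by
      simp only [Fin.tail]
      omega
    rw [this, Fin.cons_self_tail]
    ext i
    simp
  rw [h2] at h1
  refine h1.trans ?_
  rw [Finset.prod_pow_eq_pow_sum, ← mul_pow, ← pow_succ']
  gcongr
  linarith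

/-! ## Sections of noble families are analytic -/

lemma zeroExt_apply {E : Type*} [TopologicalSpace E] {U : Opens E} (f : U → K) (x : U) :
    FunctionSheaf.zeroExt f x = f x :=
  Subtype.val_injective.extend_apply f 0 x

lemma zeroExt_restrict_apply {E : Type*} [TopologicalSpace E] {U V : Opens E} (h : V ≤ U)
    (f : U → K) {x : E} (hx : x ∈ V) :
    FunctionSheaf.zeroExt (fun x : V => f ⟨x, h x.2⟩) x = FunctionSheaf.zeroExt f x := by
  rw [zeroExt_apply _ (⟨x, hx⟩ : V), zeroExt_apply f ⟨x, h hx⟩]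

lemma HasFormalSeriesAt.congr {f g : (Fin d → F) → K} {u : Fin d → F}
    {P : MvPowerSeries (Fin d) K} (h : HasFormalSeriesAt f u P) (hfg : f =ᶠ[𝓝 u] g) :
    HasFormalSeriesAt g u P := fun N =>
  (h N).congr' (hfg.mono fun x hx => by simp only [hx]) EventuallyEq.rfl

/-- The pointwise limit near `u` of functions given by power series with coefficients of uniformly
geometric growth is analytic at `u`. -/
lemma analyticAt_of_tendsto_tsum_seriesTerm [CompleteSpace K] {P : ℕ → MvPowerSeries (Fin d) K}
    {u : Fin d → F} {f : (Fin d → F) → K} {C B ρ : ℝ} (hB : 0 < B) (hρ : 0 < ρ) (hρB : ρ * B < 1)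
    (hP : ∀ n (α : Fin d →₀ ℕ), ‖MvPowerSeries.coeff α (P n)‖ ≤ C * ∏ i, B ^ α i)
    (hf : ∀ x, ‖x - u‖ < ρ →
      Tendsto (fun n => ∑' α, seriesTerm (P n) u x α) atTop (𝓝 (f x))) : AnalyticAt F f u := by
  have hlim : ∀ α : Fin d →₀ ℕ,
      ∃ l, Tendsto (fun n => MvPowerSeries.coeff α (P n)) atTop (𝓝 l) := by
    intro α
    have := exists_tendsto_coeff_pi (F := F) (C := C)
      (p := fun n β => MvPowerSeries.coeff (Finsupp.equivFunOnFinite.symm β) (P n)) hB hρ hρB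
      (fun n β => hP n _) (fun x hx => ?_) α
    · simpa using this
    · have hx' : ‖u + x - u‖ < ρ := by
        rw [add_sub_cancel_left]
        exact (pi_norm_lt_iff hρ).2 hx
      refine ⟨f (u + x), (hf _ hx').congr fun n => ?_⟩
      rw [← (Finsupp.equivFunOnFinite : (Fin d →₀ ℕ) ≃ (Fin d → ℕ)).symm.tsum_eq]
      refine tsum_congr fun β => ?_
      simp [seriesTerm]
  choose l hl using hlim
  let Q : MvPowerSeries (Fin d) K := l
  have hQ : ∀ α, MvPowerSeries.coeff α Q = l α := fun α => rfl
  refine analyticAt_of_eq_tsum_seriesTerm (P := Q) hB hρ hρB (C := C) (fun α => ?_) fun x hx => ?_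
  · rw [hQ]
    exact le_of_tendsto (hl α).norm (Eventually.of_forall fun n => hP n α)
  · refine tendsto_nhds_unique (hf x hx) ?_
    refine tendsto_tsum_of_dominated_convergence
      ((summable_prod_pow_finsupp d (mul_pos hρ hB).le hρB).mul_left C) (fun α => ?_)
      (Eventually.of_forall fun n α => norm_seriesTerm_le (hP n) hx.le α)
    exact (hl α).const_smul _

theorem IsNoble.analyticOnNhd [CompleteSpace K] {S : FunctionSheaf (Fin (d + 1) → F) K}
    (hS : IsNoble S) {U : Opens (Fin (d + 1) → F)} {f : U → K} (hf : f ∈ S.sections U) :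
    AnalyticOnNhd F (FunctionSheaf.zeroExt f) (U : Set (Fin (d + 1) → F)) := by
  obtain ⟨-, X, r, c, G, hX, hslice, hconv, hfin, hmono, hctop, hcoeff,
    ⟨⟨hsmooth, hgentric⟩, -⟩, hGS, hdense⟩ := hS
  intro u hu
  obtain ⟨ε, hε, hεU⟩ := Metric.nhds_basis_closedBall.mem_iff.1 (U.isOpen.mem_nhds hu)
  let V : Opens (Fin (d + 1) → F) := ⟨Metric.ball u ε, Metric.isOpen_ball⟩
  have hVU : V ≤ U := fun x hx => hεU (Metric.ball_subset_closedBall hx)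
  have hbdd : Bornology.IsBounded (V : Set (Fin (d + 1) → F)) := Metric.isBounded_ball
  have hclos : closure (V : Set (Fin (d + 1) → F)) ⊆ U :=
    Metric.closure_ball_subset_closedBall.trans hεU
  have huV : u ∈ V := Metric.mem_ball_self hε
  have hfV := S.restrict_mem hVU hf
  choose g hg hgr using fun n : ℕ => hdense U V hVU hbdd hclos f hf ((n : ℝ≥0∞)⁻¹)
    (ENNReal.inv_pos.2 (ENNReal.natCast_ne_top n))
  have hr0 : Tendsto (fun n => r V (g n - fun x : V => f ⟨x, hVU x.2⟩)) atTop (𝓝 0) :=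
    tendsto_of_tendsto_of_tendsto_of_le_of_le tendsto_const_nhds ENNReal.tendsto_inv_nat_nhds_zero
      (fun _ => zero_le) fun n => (hgr n).le
  obtain ⟨hunif, hrt⟩ := hconv V _ hfV g (fun n => hGS V (hg n)) hr0
  have hrf := hfin V U hVU hbdd hclos f hf
  -- A finite bound for `r V (g n)` from some `n₀` on. By monotonicity of `c` it gives slice
  -- estimates independent of `n`, and the sequence is henceforth shifted by `n₀`.
  set R := r V (fun x : V => f ⟨x, hVU x.2⟩) + 1 with hR
  have hRtop : R ≠ ⊤ := ENNReal.add_ne_top.2 ⟨hrf, ENNReal.one_ne_top⟩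
  have hlt : ∀ᶠ n in atTop, r V (g n) < R :=
    hrt.eventually_lt_const (ENNReal.lt_add_right hrf one_ne_zero)
  obtain ⟨n₀, hn₀⟩ := eventually_atTop.1 hlt
  choose P hP using fun n => (hsmooth V (g (n + n₀)) (hg _)).2 ⟨u, huV⟩
  obtain ⟨C, B, hB, hbound⟩ := exists_norm_coeff_le_of_isSpread hX P fun x hx => by
    refine ⟨(c x u R V).toReal, fun n k => ?_⟩
    obtain ⟨p, hp⟩ := hslice V _ (hGS V (hg (n + n₀))) ⟨u, huV⟩ x hx
    rw [← (hP n).coeff_slice_eq hp]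
    have h1 := hcoeff V _ (hGS V (hg (n + n₀))) ⟨u, huV⟩ x hx p hp k
    have h2 := h1.trans (pow_le_pow_left' (hmono x u V (hn₀ (n + n₀) (Nat.le_add_left _ _)).le) _)
    have h3 := ENNReal.toReal_mono (ENNReal.pow_ne_top (hctop x u R V hRtop)) h2
    simpa using h3
  set ρ := min ε (1 / (2 * B)) with hρ
  have hρ0 : 0 < ρ := by positivity
  have hρB : ρ * B < 1 := by
    have : ρ * B ≤ 1 / (2 * B) * B := by gcongr; exact min_le_right _ _
    have h2 : 1 / (2 * B) * B = 1 / 2 := by field_simp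
    linarith
  -- The gentric property needs convergence on the whole open set, so the approximants are
  -- restricted to a ball inside the common domain of convergence.
  let V' : Opens (Fin (d + 1) → F) := ⟨Metric.ball u ρ, Metric.isOpen_ball⟩
  have hV' : V' ≤ V := Metric.ball_subset_ball (min_le_left _ _)
  refine analyticAt_of_tendsto_tsum_seriesTerm hB hρ0 hρB hbound fun x hx => ?_
  have hxV' : x ∈ V' := by simpa [V', dist_eq_norm] using hx
  have huV' : u ∈ V' := Metric.mem_ball_self hρ0
  have hsum : ∀ n, ∑' α, seriesTerm (P n) u x α = g (n + n₀) ⟨x, hV' hxV'⟩ := by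
    intro n
    refine (hgentric V' _ (G.restrict_mem hV' (hg (n + n₀))) ⟨u, huV'⟩ (P n)
      ((hP n).congr ?_) (fun y => ?_) ⟨x, hxV'⟩).symm
    · filter_upwards [V'.isOpen.mem_nhds huV'] with y hy
      exact (zeroExt_restrict_apply hV' _ hy).symm
    · exact summable_seriesTerm hB hρB (hbound n)
        (by simpa [dist_eq_norm] using (Metric.mem_ball.1 y.2).le)
  simp_rw [hsum]
  rw [zeroExt_apply f ⟨x, hVU (hV' hxV')⟩]
  exact (hunif.tendsto_at ⟨x, hV' hxV'⟩).comp (tendsto_add_atTop_nat n₀)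

end

/-! ## Extensions to the wedge -/

section
variable {F K : Type*} [NontriviallyNormedField F] [NormedField K] [NormedAlgebra F K] {d : ℕ}
  {Γ : Set (Fin d → K)} {A : AddSubgroup (Γ → K)} {U : Opens (Fin d → F)}

lemma continuous_toExt : Continuous (toExt (F := F) (d := d) K) :=
  continuous_pi fun i => (continuous_algebraMap F K).comp (continuous_apply i)

lemma IsWedgeExtension.add {f h : U → K} {g k : (Fin d → K) → K} (hg : IsWedgeExtension Γ A f g)
    (hk : IsWedgeExtension Γ A h k) : IsWedgeExtension Γ A (f + h) (g + k) :=
  ⟨hg.1.add hk.1, A.add_mem hg.2.1 hk.2.1, fun u => by simp [hg.2.2 u, hk.2.2 u]⟩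

lemma IsWedgeExtension.sub {f h : U → K} {g k : (Fin d → K) → K} (hg : IsWedgeExtension Γ A f g)
    (hk : IsWedgeExtension Γ A h k) : IsWedgeExtension Γ A (f - h) (g - k) :=
  ⟨hg.1.sub hk.1, A.sub_mem hg.2.1 hk.2.1, fun u => by simp [hg.2.2 u, hk.2.2 u]⟩

lemma IsWedgeExtension.restrict {W : Opens (Fin d → F)} (hUW : U ≤ W) {f : W → K}
    {g : (Fin d → K) → K} (hg : IsWedgeExtension Γ A f g) :
    IsWedgeExtension Γ A (fun x : U => f ⟨x, hUW x.2⟩) g :=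
  ⟨hg.1.mono (Set.union_subset_union_right _ (Set.image_mono hUW)), hg.2.1,
    fun u => hg.2.2 ⟨u, hUW u.2⟩⟩

lemma wedgeSup_add_le (N : Set (Fin d → K)) (g k : (Fin d → K) → K) :
    wedgeSup Γ U N (g + k) ≤ wedgeSup Γ U N g + wedgeSup Γ U N k :=
  iSup₂_le fun z hz => (enorm_add_le _ _).trans
    (add_le_add (le_iSup₂ (f := fun z _ => ‖g z‖ₑ) z hz) (le_iSup₂ (f := fun z _ => ‖k z‖ₑ) z hz))

lemma wedgeSup_sub_le (N : Set (Fin d → K)) (g k : (Fin d → K) → K) :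
    wedgeSup Γ U N (g - k) ≤ wedgeSup Γ U N g + wedgeSup Γ U N k :=
  iSup₂_le fun z hz => enorm_sub_le.trans
    (add_le_add (le_iSup₂ (f := fun z _ => ‖g z‖ₑ) z hz) (le_iSup₂ (f := fun z _ => ‖k z‖ₑ) z hz))

lemma wedgeSup_mono {N N' : Set (Fin d → K)} (h : N ⊆ N') (g : (Fin d → K) → K) :
    wedgeSup Γ U N g ≤ wedgeSup Γ U N' g :=
  biSup_mono fun _ hz => ⟨h hz.1, hz.2⟩

lemma wedgeNorm_mono {N N' : Set (Fin d → K)} (h : N ⊆ N') (f : U → K) :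
    wedgeNorm Γ A U N f ≤ wedgeNorm Γ A U N' f :=
  iInf₂_mono fun g _ => wedgeSup_mono h g

lemma exists_wedgeSup_lt {N : Set (Fin d → K)} {f : U → K} {t : ℝ≥0∞}
    (h : wedgeNorm Γ A U N f < t) : ∃ g, IsWedgeExtension Γ A f g ∧ wedgeSup Γ U N g < t := by
  simpa [wedgeNorm, iInf_lt_iff] using h

lemma wedgeNorm_eq_iInf (N : Set (Fin d → K)) (f : U → K) : wedgeNorm Γ A U N f =
    ⨅ g : {g : (Fin d → K) → K // IsWedgeExtension Γ A f g}, wedgeSup Γ U N g.1 :=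
  iInf_subtype'

lemma wedgeNorm_le_wedgeSup {N : Set (Fin d → K)} {f : U → K} {g : (Fin d → K) → K}
    (hg : IsWedgeExtension Γ A f g) : wedgeNorm Γ A U N f ≤ wedgeSup Γ U N g :=
  iInf₂_le g hg

lemma wedgeNorm_add_le (N : Set (Fin d → K)) (f h : U → K) :
    wedgeNorm Γ A U N (f + h) ≤ wedgeNorm Γ A U N f + wedgeNorm Γ A U N h := by
  rw [wedgeNorm_eq_iInf N f, wedgeNorm_eq_iInf N h, ENNReal.iInf_add]
  refine le_iInf fun g => ?_
  rw [ENNReal.add_iInf]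
  exact le_iInf fun k => (wedgeNorm_le_wedgeSup (g.2.add k.2)).trans (wedgeSup_add_le N _ _)

lemma wedgeNorm_sub_le (N : Set (Fin d → K)) (f h : U → K) :
    wedgeNorm Γ A U N (f - h) ≤ wedgeNorm Γ A U N f + wedgeNorm Γ A U N h := by
  rw [wedgeNorm_eq_iInf N f, wedgeNorm_eq_iInf N h, ENNReal.iInf_add]
  refine le_iInf fun g => ?_
  rw [ENNReal.add_iInf]
  exact le_iInf fun k => (wedgeNorm_le_wedgeSup (g.2.sub k.2)).trans (wedgeSup_sub_le N _ _)

lemma enorm_le_wedgeNorm {N : Set (Fin d → K)} (hN : toExt K '' (U : Set (Fin d → F)) ⊆ N)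
    (f : U → K) (u : U) : ‖f u‖ₑ ≤ wedgeNorm Γ A U N f := by
  refine le_iInf₂ fun g hg => ?_
  rw [← hg.2.2 u]
  have hu : toExt K (u : Fin d → F) ∈ toExt K '' (U : Set (Fin d → F)) := ⟨u, u.2, rfl⟩
  exact le_iSup₂ (f := fun z _ => ‖g z‖ₑ) _ ⟨hN hu, Or.inr hu⟩

/-- A continuous extension is locally bounded at the points of `W`. By compactness of the closure of
`U`, one bound holds on an open neighbourhood of its image, and this neighbourhood contains a
thickening. -/
lemma exists_wedgeNorm_ne_top_of_isCompact {W : Opens (Fin d → F)} (hUW : U ≤ W)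
    (hcpt : IsCompact (closure (U : Set (Fin d → F))))
    (hclos : closure (U : Set (Fin d → F)) ⊆ W) {f : W → K} {g : (Fin d → K) → K}
    (hg : IsWedgeExtension Γ A f g) :
    ∃ δ : ℝ, 0 < δ ∧ wedgeNorm Γ A U (Metric.thickening δ (toExt K '' (U : Set (Fin d → F))))
      (fun x : U => f ⟨x, hUW x.2⟩) ≠ ⊤ := by
  set E := Γ ∪ toExt K '' (W : Set (Fin d → F)) with hE
  set O : ℕ → Set (Fin d → K) := fun n => interior {z | z ∈ E → ‖g z‖ ≤ n} with hO
  have hmono : Monotone O := fun m n hmn => interior_mono fun z hz hzE =>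
    (hz hzE).trans (by exact_mod_cast hmn)
  have hcover : toExt K '' closure (U : Set (Fin d → F)) ⊆ ⋃ n, O n := by
    rintro _ ⟨x, hx, rfl⟩
    have hxE : toExt K x ∈ E := Or.inr ⟨x, hclos hx, rfl⟩
    obtain ⟨n, hn⟩ := exists_nat_gt ‖g (toExt K x)‖
    have h1 := (hg.1 _ hxE).norm.eventually_lt_const hn
    rw [eventually_nhdsWithin_iff] at h1
    refine Set.mem_iUnion.2 ⟨n, mem_interior_iff_mem_nhds.2 ?_⟩
    filter_upwards [h1] with z hz hzE using (hz hzE).le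
  have hcpt' := hcpt.image (continuous_toExt (K := K))
  obtain ⟨n, hn⟩ := hcpt'.elim_directed_cover O (fun n => isOpen_interior) hcover
    hmono.directed_le
  obtain ⟨δ, hδ, hthick⟩ := hcpt'.exists_thickening_subset_open isOpen_interior hn
  refine ⟨δ, hδ, ne_top_of_le_ne_top (ENNReal.ofReal_ne_top (r := n)) ?_⟩
  refine (wedgeNorm_le_wedgeSup (hg.restrict hUW)).trans (iSup₂_le fun z hz => ?_)
  rw [← ofReal_norm]
  refine ENNReal.ofReal_le_ofReal (interior_subset (hthick
    (Metric.thickening_subset_of_subset _ (Set.image_mono subset_closure) hz.1)) ?_)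
  exact Set.union_subset_union_right _ (Set.image_mono hUW) hz.2

end

/-! ### A gauge that allows the neighbourhood to shrink -/

section
variable {F K : Type*} [NontriviallyNormedField F] [NormedField K] [NormedAlgebra F K] {d : ℕ}
  {Γ : Set (Fin d → K)} {A : AddSubgroup (Γ → K)} {U : Opens (Fin d → F)}

/-- A shrinking sequence of neighbourhoods of `U` inside `N`. -/
def wedgeNhd (U : Opens (Fin d → F)) (N : Set (Fin d → K)) (k : ℕ) : Set (Fin d → K) :=
  N ∩ Metric.thickening (1 / ((k : ℝ) + 1)) (toExt K '' (U : Set (Fin d → F)))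

lemma wedgeNhd_mem_nhdsSet {N : Set (Fin d → K)}
    (hN : N ∈ 𝓝ˢ (toExt K '' (U : Set (Fin d → F)))) (k : ℕ) :
    wedgeNhd U N k ∈ 𝓝ˢ (toExt K '' (U : Set (Fin d → F))) :=
  inter_mem hN (Metric.isOpen_thickening.mem_nhdsSet.2
    (Metric.self_subset_thickening (by positivity) _))

lemma wedgeNhd_subset_zero (N : Set (Fin d → K)) (k : ℕ) : wedgeNhd U N k ⊆ wedgeNhd U N 0 :=
  Set.inter_subset_inter_right _ (Metric.thickening_mono
    (one_div_le_one_div_of_le (by positivity) (by simp)) _)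

/-- The best bound `t` for extensions of `f` on some neighbourhood `wedgeNhd U N k` with `k ≤ t`. -/
noncomputable def wedgeGauge (Γ : Set (Fin d → K)) (A : AddSubgroup (Γ → K)) (U : Opens (Fin d → F))
    (N : Set (Fin d → K)) (f : U → K) : ℝ≥0∞ :=
  ⨅ k : ℕ, max (k : ℝ≥0∞) (wedgeNorm Γ A U (wedgeNhd U N k) f)

lemma wedgeGauge_le_wedgeNorm (N : Set (Fin d → K)) (f : U → K) :
    wedgeGauge Γ A U N f ≤ wedgeNorm Γ A U N f :=
  (iInf_le _ 0).trans (max_le (by simp) (wedgeNorm_mono Set.inter_subset_left f))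

/-- Every index `k ≥ 1` costs at least `1`, so a gauge below `1` must come from the index `0`.
Convergence to zero in the gauge therefore takes place on a fixed neighbourhood. -/
lemma wedgeNorm_le_wedgeGauge {N : Set (Fin d → K)} {f : U → K} (h : wedgeGauge Γ A U N f < 1) :
    wedgeNorm Γ A U (wedgeNhd U N 0) f ≤ wedgeGauge Γ A U N f := by
  refine le_iInf fun k => ?_
  rcases Nat.eq_zero_or_pos k with rfl | hk
  · exact le_max_right _ _
  · have h1 : (1 : ℝ≥0∞) ≤ k := by exact_mod_cast hk
    refine le_trans ?_ (h1.trans (le_max_left _ _))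
    obtain ⟨j, hj⟩ := iInf_lt_iff.1 h
    obtain ⟨hj1, hj2⟩ := max_lt_iff.1 hj
    have : j = 0 := by
      have : j < 1 := by exact_mod_cast hj1
      omega
    subst this
    exact hj2.le

/-- The perturbation `h` is measured on the largest neighbourhood, so it bounds the change for every
index `k` at once. -/
lemma wedgeGauge_add_le (N : Set (Fin d → K)) (f h : U → K) : wedgeGauge Γ A U N (f + h) ≤
    wedgeGauge Γ A U N f + wedgeNorm Γ A U (wedgeNhd U N 0) h := by
  rw [wedgeGauge, wedgeGauge, ENNReal.iInf_add]
  refine iInf_mono fun k => max_le ((le_max_left _ _).trans le_self_add) ?_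
  exact (wedgeNorm_add_le _ f h).trans
    (add_le_add (le_max_right _ _) (wedgeNorm_mono (wedgeNhd_subset_zero N k) h))

lemma wedgeGauge_sub_le (N : Set (Fin d → K)) (f h : U → K) : wedgeGauge Γ A U N (f - h) ≤
    wedgeGauge Γ A U N f + wedgeNorm Γ A U (wedgeNhd U N 0) h := by
  rw [wedgeGauge, wedgeGauge, ENNReal.iInf_add]
  refine iInf_mono fun k => max_le ((le_max_left _ _).trans le_self_add) ?_
  exact (wedgeNorm_sub_le _ f h).trans
    (add_le_add (le_max_right _ _) (wedgeNorm_mono (wedgeNhd_subset_zero N k) h))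

lemma tendsto_wedgeNorm_of_tendsto_wedgeGauge {N : Set (Fin d → K)} {hs : ℕ → U → K}
    (h : Tendsto (fun n => wedgeGauge Γ A U N (hs n)) atTop (𝓝 0)) :
    Tendsto (fun n => wedgeNorm Γ A U (wedgeNhd U N 0) (hs n)) atTop (𝓝 0) :=
  tendsto_of_tendsto_of_tendsto_of_le_of_le' tendsto_const_nhds h
    (Eventually.of_forall fun _ => zero_le)
    ((h.eventually_lt_const one_pos).mono fun _ hn => wedgeNorm_le_wedgeGauge hn)

lemma tendsto_wedgeGauge {N : Set (Fin d → K)} {f : U → K} {fs : ℕ → U → K}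
    (h : Tendsto (fun n => wedgeGauge Γ A U N (fs n - f)) atTop (𝓝 0)) :
    Tendsto (fun n => wedgeGauge Γ A U N (fs n)) atTop (𝓝 (wedgeGauge Γ A U N f)) := by
  have h0 := tendsto_wedgeNorm_of_tendsto_wedgeGauge h
  have hlow := ENNReal.Tendsto.sub (tendsto_const_nhds (x := wedgeGauge Γ A U N f)) h0
    (Or.inr ENNReal.zero_ne_top)
  have hupp := (tendsto_const_nhds (x := wedgeGauge Γ A U N f)).add h0
  rw [tsub_zero] at hlow
  rw [add_zero] at hupp
  refine tendsto_of_tendsto_of_tendsto_of_le_of_le hlow hupp (fun n => ?_) fun n => ?_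
  · refine tsub_le_iff_right.2 ?_
    have := wedgeGauge_sub_le (Γ := Γ) (A := A) N (fs n) (fs n - f)
    rwa [sub_sub_cancel] at this
  · have := wedgeGauge_add_le (Γ := Γ) (A := A) N f (fs n - f)
    rwa [add_sub_cancel] at this

lemma tendstoUniformly_of_tendsto_wedgeGauge {N : Set (Fin d → K)}
    (hN : N ∈ 𝓝ˢ (toExt K '' (U : Set (Fin d → F)))) {f : U → K} {fs : ℕ → U → K}
    (h : Tendsto (fun n => wedgeGauge Γ A U N (fs n - f)) atTop (𝓝 0)) :
    TendstoUniformly fs f atTop := by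
  have h0 := tendsto_wedgeNorm_of_tendsto_wedgeGauge h
  rw [Metric.tendstoUniformly_iff]
  intro ε hε
  filter_upwards [h0.eventually_lt_const (ENNReal.ofReal_pos.2 hε)] with n hn u
  have h1 := (enorm_le_wedgeNorm (Γ := Γ) (A := A)
    (subset_of_mem_nhdsSet (wedgeNhd_mem_nhdsSet hN 0)) (fs n - f) u).trans_lt hn
  rw [← ofReal_norm, ENNReal.ofReal_lt_ofReal_iff hε] at h1
  rwa [dist_comm, dist_eq_norm]

lemma wedgeGauge_ne_top {N : Set (Fin d → K)} {f : U → K} {δ : ℝ} (hδ : 0 < δ)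
    (h : wedgeNorm Γ A U (Metric.thickening δ (toExt K '' (U : Set (Fin d → F)))) f ≠ ⊤) :
    wedgeGauge Γ A U N f ≠ ⊤ := by
  obtain ⟨k, hk⟩ := exists_nat_one_div_lt hδ
  refine ne_top_of_le_ne_top ?_ (iInf_le _ k)
  refine (max_lt (ENNReal.natCast_lt_top k) ?_).ne
  exact (wedgeNorm_mono (Set.inter_subset_right.trans (Metric.thickening_mono hk.le _)) f).trans_lt
    h.lt_top

/-- The infima need not be attained, so room of `1` is left to pick an index and an extension. For
infinite gauge any extension will do. -/
lemma exists_wedgeSup_le_wedgeGauge_add_one {N : Set (Fin d → K)} {f : U → K}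
    (hf : ∃ g, IsWedgeExtension Γ A f g) : ∃ (k : ℕ) (g : (Fin d → K) → K),
      IsWedgeExtension Γ A f g ∧ (k : ℝ≥0∞) ≤ wedgeGauge Γ A U N f + 1 ∧
      wedgeSup Γ U (wedgeNhd U N k) g ≤ wedgeGauge Γ A U N f + 1 := by
  by_cases htop : wedgeGauge Γ A U N f = ⊤
  · obtain ⟨g, hg⟩ := hf
    exact ⟨0, g, hg, by simp [htop], by simp [htop]⟩
  · obtain ⟨k, hk⟩ := iInf_lt_iff.1 (ENNReal.lt_add_right htop one_ne_zero)
    obtain ⟨hk1, hk2⟩ := max_lt_iff.1 hk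
    obtain ⟨g, hg, hgt⟩ := exists_wedgeSup_lt hk2
    exact ⟨k, g, hg, hk1.le, hgt.le⟩

lemma IsWedgeExtension.locally_bounded {f : U → K} {g : (Fin d → K) → K}
    (hg : IsWedgeExtension Γ A f g) (u : U) : ∃ W ∈ 𝓝 u, ∃ C : ℝ, ∀ x ∈ W, ‖f x‖ ≤ C := by
  have hf : f = fun x : U => g (toExt K (x : Fin d → F)) := funext fun x => (hg.2.2 x).symm
  have hcont : Continuous f := by
    rw [hf]
    exact hg.1.comp_continuous (continuous_toExt.comp continuous_subtype_val)
      fun x => Or.inr ⟨x, x.2, rfl⟩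
  exact ⟨_, (hcont.norm.tendsto u).eventually_lt_const (lt_add_one _), ‖f u‖ + 1,
    fun x hx => le_of_lt hx⟩

/-- Only finitely many indices lie below `t`. This is why the index enters the gauge as a cost: it
keeps the combined Cauchy constant finite. -/
lemma iSup_natCast_le_ne_top {t : ℝ≥0∞} (ht : t ≠ ⊤) {b : ℕ → ℝ≥0∞} (hb : ∀ k, b k ≠ ⊤) :
    ⨆ (k : ℕ) (_ : (k : ℝ≥0∞) ≤ t), b k ≠ ⊤ := by
  obtain ⟨m, hm⟩ := ENNReal.exists_nat_gt ht
  refine ne_top_of_le_ne_top (ENNReal.sum_ne_top.2 fun k (_ : k ∈ Finset.range m) => hb k) ?_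
  refine iSup₂_le fun k hk => Finset.single_le_sum (f := b) (fun _ _ => zero_le) ?_
  rw [Finset.mem_range]
  exact_mod_cast hk.trans_lt hm

end

theorem mainTheorem7 {F K : Type*} [NontriviallyNormedField F] [CompleteSpace F]
    [NormedField K] [NormedAlgebra F K] {d : ℕ}
    -- the wedge
    (Γ : Set (Fin (d + 1) → K))
    (hΓ_closure : Set.range (toExt (F := F) (d := d + 1) K) ⊆ closure Γ)
    (hΓ_slice : ∀ x v : Fin (d + 1) → F,
      (∀ z : K, z ∉ Set.range (algebraMap F K) → toExt K x + z • toExt K v ∈ Γ) ∨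
      (∀ z : K, z ∉ Set.range (algebraMap F K) → toExt K x + z • toExt K v ∉ Γ))
    (X : Set (Fin (d + 1) → F)) (hX : IsSpread X)
    (hΓX : ∀ v ∈ X, ∃ x : Fin (d + 1) → F,
      ∀ z : K, z ∉ Set.range (algebraMap F K) → toExt K x + z • toExt K v ∈ Γ)
    -- the admissible functions on the wedge
    (A : AddSubgroup (Γ → K))
    -- the sections extend continuously to the wedge
    (S : FunctionSheaf (Fin (d + 1) → F) K)
    (h_ext : ∀ U, ∀ f ∈ S.sections U, ∃ g, IsWedgeExtension Γ A f g)
    -- they are analytic along slices, with Cauchy type estimates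
    (h_slice : ∀ U, ∀ f ∈ S.sections U, ∀ u : U, ∀ v ∈ X, AnalyticAt F (slice f u v) 0)
    (h_cauchy : ∀ U : Opens (Fin (d + 1) → F),
      ∀ N ∈ 𝓝ˢ (toExt K '' (U : Set (Fin (d + 1) → F))),
      ∃ c : (Fin (d + 1) → F) → (Fin (d + 1) → F) → ℝ≥0∞ → ℝ≥0∞,
        (∀ u v, Monotone (c u v)) ∧ (∀ u v t, t ≠ ⊤ → c u v t ≠ ⊤) ∧
        ∀ f ∈ S.sections U, ∀ g, IsWedgeExtension Γ A f g → ∀ u : U, ∀ v ∈ X,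
          ∀ p : FormalMultilinearSeries F F K, HasFPowerSeriesAt (slice f u v) p 0 →
          ∀ n : ℕ, ‖p.coeff n‖ₑ ≤ c u v (wedgeSup Γ U N g) ^ (n + 1))
    -- they are approximable by a gentric subfamily
    (N : Opens (Fin (d + 1) → F) → Set (Fin (d + 1) → K))
    (hN : ∀ U : Opens (Fin (d + 1) → F), N U ∈ 𝓝ˢ (toExt K '' (U : Set (Fin (d + 1) → F))))
    (G : FunctionSheaf (Fin (d + 1) → F) K)
    (hG : IsGentricDense S G fun U => wedgeNorm Γ A U (N U))
    -- if the field is not locally compact: boundedness beside bounded sets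
    (h_bdd : ¬ LocallyCompactSpace F → ∀ U W : Opens (Fin (d + 1) → F), ∀ hUW : U ≤ W,
      Bornology.IsBounded (U : Set (Fin (d + 1) → F)) →
      closure (U : Set (Fin (d + 1) → F)) ⊆ W →
      ∀ f ∈ S.sections W, ∃ δ : ℝ, 0 < δ ∧
        wedgeNorm Γ A U (Metric.thickening δ (toExt K '' (U : Set (Fin (d + 1) → F))))
          (fun x : U => f ⟨x, hUW x.2⟩) ≠ ⊤) :
    IsNoble S ∧
      (CompleteSpace K → ∀ U, ∀ f ∈ S.sections U,
        AnalyticOnNhd F (FunctionSheaf.zeroExt f) (U : Set (Fin (d + 1) → F))) := by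
  have hnoble : IsNoble S := by
    choose c hcmono hctop hc using fun (U : Opens (Fin (d + 1) → F)) (k : ℕ) =>
      h_cauchy U (wedgeNhd U (N U) k) (wedgeNhd_mem_nhdsSet (hN U) k)
    refine ⟨fun U f hf u => (h_ext U f hf).elim fun g hg => hg.locally_bounded u, X,
      fun U => wedgeGauge Γ A U (N U),
      -- Gauge `t` provides an extension bounded by `t + 1` on some neighbourhood of unknown index
      -- `k ≤ t + 1`, so the supremum over these indices is taken.
      fun v u t U => ⨆ (k : ℕ) (_ : (k : ℝ≥0∞) ≤ t + 1), c U k u v (t + 1),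
      G, hX, h_slice, fun U f _ fs _ h => ⟨tendstoUniformly_of_tendsto_wedgeGauge (hN U) h,
        tendsto_wedgeGauge h⟩, ?_, ?_, ?_, ?_, hG.1, hG.2.1, ?_⟩
    · intro U W hUW hbdd hclos f hf
      obtain ⟨δ, hδ, h⟩ : ∃ δ : ℝ, 0 < δ ∧
          wedgeNorm Γ A U (Metric.thickening δ (toExt K '' (U : Set (Fin (d + 1) → F))))
            (fun x : U => f ⟨x, hUW x.2⟩) ≠ ⊤ := by
        by_cases hF : LocallyCompactSpace F
        · have : ProperSpace F := .of_locallyCompactSpace F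
          obtain ⟨g, hg⟩ := h_ext W f hf
          exact exists_wedgeNorm_ne_top_of_isCompact hUW hbdd.isCompact_closure hclos hg
        · exact h_bdd hF U W hUW hbdd hclos f hf
      exact wedgeGauge_ne_top hδ h
    · intro v u U s t hst
      have hst' : s + 1 ≤ t + 1 := by gcongr
      exact iSup₂_le fun k hk => (hcmono U k u v hst').trans
        (le_iSup₂ (f := fun (k : ℕ) (_ : (k : ℝ≥0∞) ≤ t + 1) => c U k u v (t + 1)) k
          (hk.trans hst'))
    · intro v u t U ht
      have ht' : t + 1 ≠ ⊤ := ENNReal.add_ne_top.2 ⟨ht, ENNReal.one_ne_top⟩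
      exact iSup_natCast_le_ne_top ht' fun k => hctop U k u v _ ht'
    · intro U f hf u v hv p hp n
      obtain ⟨k, g, hg, hk, hgt⟩ := exists_wedgeSup_le_wedgeGauge_add_one (N := N U) (h_ext U f hf)
      refine (hc U k f hf g hg u v hv p hp n).trans (pow_le_pow_left' ?_ _)
      exact (hcmono U k u v hgt).trans (le_iSup₂ (f := fun (k : ℕ)
        (_ : (k : ℝ≥0∞) ≤ wedgeGauge Γ A U (N U) f + 1) =>
          c U k u v (wedgeGauge Γ A U (N U) f + 1)) k hk)
    -- The gauge is dominated by the prescribed `wedgeNorm`, so density carries over.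
    · intro U V hVU hbdd hclos f hf ε hε
      obtain ⟨g, hg, hgε⟩ := hG.2.2 U V hVU hbdd hclos f hf ε hε
      exact ⟨g, hg, (wedgeGauge_le_wedgeNorm _ _).trans_lt hgε⟩
  exact ⟨hnoble, fun _ U f hf => hnoble.analyticOnNhd hf⟩
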